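/- Let $m\ge 1$ be an integer and $T>0$. Let $\mathcal K\subset\mathbb R^m$ be nonempty and compact, and let $f:[0,T]\times\mathbb R^m\times\mathcal K\to\mathbb R^m$, $g:[0,T]\times\mathbb R^m\times\mathbb R^m\to\mathbb R^m$, $C:[0,T]\times\mathbb R^m\times\mathbb R^m\to\mathbb R$, $\psi:[0,T]\times\mathbb R^m\times\mathcal K\to\mathbb R$ and $G:\mathbb R^m\to\mathbb R$ satisfy, for some constants $c\ge 0$ and $\alpha>0$: 1. $f,g$ are continuous, $|f(t,x,\tau)|+|g(t,x,\xi)|\le c(1+|x|)$ and $|g(t,x,\xi)-g(t,x',\xi)|+|f(t,x,\tau)-f(t,x',\tau)|\le c|x-x'|$; for each $x$ the functions $t\mapsto g(t,x,\xi)$, $\xi\in\mathbb R^m$, are equicontinuous on $[0,T]$; 2. $C$ is continuous, the functions $(t,x)\mapsto C(t,x,\xi)$, $\xi\in\mathbb R^m$, are equicontinuous on $[0,T]\times\mathbb R^m$, $|C(t,x,\xi)|\le c(1+|x|)$ and $C(t,x,\xi)\ge\alpha$; 3. $\psi$ is continuous and bounded from below, and $|\psi(t,x,\tau)|\le c(1+|x|)$;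 4. $G$ is uniformly continuous and bounded from below, and $|G(x)|\le c(1+|x|)$. For $t_0\in[0,T]$ let $\Omega$ be the set of measurable $\tau:[t_0,T]\to\mathcal K$. An impulse control is a pair of sequences $t_0\le t_1\le t_2\le\cdots$ and $\xi_k\in\mathbb R^m\setminus\{0\}$ $(k\ge1)$ with only finitely many $t_k\le T$ (only these jumps take place). With $x\in\mathbb R^m$ they generate the trajectory $y$ with $y(t_0)=x$, $\dot y(t)=f(t,y(t),\tau(t))$ between jumps and $y(t_k^+)=y(t_k^-)+g(t_k,y(t_k^-),\xi_k)$, jumps at the same instant being performed one after the other. The pay-off is $$J=\int_{t_0}^T\psi(s,y(s),\tau(s))\,ds+\sum_{k:\,t_k\le T}C(t_k,y(t_k^-),\xi_k)+G(y(T^+)),$$ where for successive jumps at one instant $y(t_k^-)$ means the state just before the $k$-th jump, and $y(T^+)$ is the state after the jumps at time $T$. A non-anticipative strategy is a map $\varphi$ from $\Omega$ to impulse controls such that, for all $t\in[t_0,T]$, $\tau_1=\tau_2$ on $[t_0,t)$ implies that $\varphi(\tau_1)$ and $\varphi(\tau_2)$ have the same jumps on $[t_0,t]$. The value function is $$v(t_0,x)=\inf_{\varphi}\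 \sup_{\tau\in\Omega}J(t_0,x,\varphi(\tau),\tau).$$ For a finite sequence $\xi=(\xi_1,\dots,\xi_n)$ of nonzero vectors let $x+g(t,x,\xi)$ be the state reached from $x$ by performing successively the jumps $\xi_1,\dots,\xi_n$ at time $t$, and $C(t,x,\xi)$ their total cost. For $\kappa\in(0,\infty]$ and $w:[0,T]\times\mathbb R^m\to\mathbb R$ put $$N[w](t,x)=\inf_\xi\,[\,w(t,x+g(t,x,\xi))+C(t,x,\xi)\,],$$ the infimum over all such sequences of length $1\le n\le\kappa(1+|x|)$, and $G_1(x)=\min\{G(x),N[G](T,x)\}$. Theorem. The value function $v$ is real-valued on $[0,T]\times\mathbb R^m$, and there is a constant $\kappa_0$ such that for every $\kappa\in[\kappa_0,\infty]$ (with $\kappa>0$) and every $t_0\in[0,T)$ the function $v$ is a viscosity solution of $$\max\Big\{\min_{\tau\in\mathcal K}\Big[-\frac{\partial v}{\partial t}-\frac{\partial v}{\partial x}f(t,x,\tau)-\psi(t,x,\tau)\Big],\ v(t,x)-N[v](t,x)\Big\}=0\quad\text{on }[t_0,T)\times\mathbb R^m,\qquad v(T,x)=G_1(x).$$ This means: $v$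 is continuous on $[0,T]\times\mathbb R^m$; $v(T,\cdot)=G_1$; and for every $(\bar t,\bar x)\in[t_0,T)\times\mathbb R^m$ and every $\varphi\in C^{1,2}([t_0,T)\times\mathbb R^m)$ with $\varphi(\bar t,\bar x)=v(\bar t,\bar x)$, the number $$\max\Big\{\min_{\tau\in\mathcal K}\big[-\partial_t\varphi-\partial_x\varphi\, f(\bar t,\bar x,\tau)-\psi(\bar t,\bar x,\tau)\big](\bar t,\bar x),\ v(\bar t,\bar x)-N[v](\bar t,\bar x)\Big\}$$ is $\ge0$ if $\varphi-v$ has a local maximum (relative to $[t_0,T)\times\mathbb R^m$) at $(\bar t,\bar x)$, and $\le0$ if $\varphi-v$ has a local minimum there. -/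

import Mathlib

open Set MeasureTheory Filter Topology
open scoped NNReal ENNReal

noncomputable section

/-- The state space `ℝ^m` with its Euclidean norm. -/
abbrev StateSpace (m : ℕ) : Type := EuclideanSpace ℝ (Fin m)

/-- Data of the two-player impulse control game: horizon `T`, compact control set `K`, drift `f`,
jump map `g`, impulse cost `C`, running cost `ψ`, terminal cost `G`. Only the values at times in
`[0, T]` and at continuous controls in `K` are ever used. -/
structure ImpulseGame (m : ℕ) where
  T : ℝ
  K : Set (StateSpace m)
  f : ℝ → StateSpace m → StateSpace m → StateSpace m
  g : ℝ → StateSpace m → StateSpace m → StateSpace m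
  C : ℝ → StateSpace m → StateSpace m → ℝ
  ψ : ℝ → StateSpace m → StateSpace m → ℝ
  G : StateSpace m → ℝ

namespace ImpulseGame

variable {m : ℕ}

/-- The standing assumptions on the data. -/
structure Standing (D : ImpulseGame m) : Prop where
  T_pos : 0 < D.T
  K_compact : IsCompact D.K
  K_nonempty : D.K.Nonempty
  f_cont : ContinuousOn (fun p : ℝ × StateSpace m × StateSpace m => D.f p.1 p.2.1 p.2.2)
    (Icc 0 D.T ×ˢ (univ ×ˢ D.K))
  g_cont : ContinuousOn (fun p : ℝ × StateSpace m × StateSpace m => D.g p.1 p.2.1 p.2.2)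
    (Icc 0 D.T ×ˢ (univ ×ˢ univ))
  /-- `g` is continuous in time uniformly with respect to the impulse. -/
  g_equicont : ∀ x, EquicontinuousOn (fun (ξ : StateSpace m) (t : ℝ) => D.g t x ξ) (Icc 0 D.T)
  growth_lipschitz : ∃ c : ℝ, 0 ≤ c ∧ ∀ t ∈ Icc 0 D.T, ∀ τ ∈ D.K, ∀ ξ x x' : StateSpace m,
    ‖D.f t x τ‖ + ‖D.g t x ξ‖ ≤ c * (1 + ‖x‖) ∧
    ‖D.g t x ξ - D.g t x' ξ‖ + ‖D.f t x τ - D.f t x' τ‖ ≤ c * ‖x - x'‖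
  C_cont : ContinuousOn (fun p : ℝ × StateSpace m × StateSpace m => D.C p.1 p.2.1 p.2.2)
    (Icc 0 D.T ×ˢ (univ ×ˢ univ))
  /-- `C` is continuous in time and state uniformly with respect to the impulse. -/
  C_equicont : EquicontinuousOn
    (fun (ξ : StateSpace m) (p : ℝ × StateSpace m) => D.C p.1 p.2 ξ) (Icc 0 D.T ×ˢ univ)
  C_growth : ∃ c : ℝ, ∀ t ∈ Icc 0 D.T, ∀ x ξ, |D.C t x ξ| ≤ c * (1 + ‖x‖)
  C_lower : ∃ α : ℝ, 0 < α ∧ ∀ t ∈ Icc 0 D.T, ∀ x ξ, α ≤ D.C t x ξ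
  ψ_cont : ContinuousOn (fun p : ℝ × StateSpace m × StateSpace m => D.ψ p.1 p.2.1 p.2.2)
    (Icc 0 D.T ×ˢ (univ ×ˢ D.K))
  ψ_growth : ∃ c : ℝ, ∀ t ∈ Icc 0 D.T, ∀ x, ∀ τ ∈ D.K, |D.ψ t x τ| ≤ c * (1 + ‖x‖)
  ψ_lower : ∃ b : ℝ, ∀ t ∈ Icc 0 D.T, ∀ x, ∀ τ ∈ D.K, b ≤ D.ψ t x τ
  G_unifCont : UniformContinuous D.G
  G_growth : ∃ c : ℝ, ∀ x, |D.G x| ≤ c * (1 + ‖x‖)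
  G_lower : ∃ b : ℝ, ∀ x, b ≤ D.G x

/-- Controls of the maximizer: measurable functions with values in `K`. They are represented by
functions on all of `ℝ`; only their values on `[t₀, T]` matter below. -/
def Control (D : ImpulseGame m) : Type :=
  {τ : ℝ → StateSpace m // Measurable τ ∧ ∀ s, τ s ∈ D.K}

/-- Controls of the minimizer on `[t₀, T]`: nondecreasing jump instants and nonzero impulses.
Instants later than `T` mean that the corresponding jump does not take place. Only finitely many
jumps take place (infinitely many would not define a trajectory up to `T`, and would have infinite
total cost because each jump costs at least a fixed positive amount). -/
structure ImpulseControl (D : ImpulseGame m) (t₀ : ℝ) where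
  time : ℕ → ℝ
  impulse : ℕ → StateSpace m
  le_time : ∀ k, t₀ ≤ time k
  monotone_time : Monotone time
  impulse_ne_zero : ∀ k, impulse k ≠ 0
  finite_jumps : {k | time k ≤ D.T}.Finite

/-- The indices of the jumps that take place. -/
def ImpulseControl.jumps {D : ImpulseGame m} {t₀ : ℝ} (d : D.ImpulseControl t₀) : Finset ℕ :=
  d.finite_jumps.toFinset

/-- Two impulse controls have the same restriction to `[t₀, t]`. -/
def ImpulseControl.AgreeUpTo {D : ImpulseGame m} {t₀ : ℝ} (d e : D.ImpulseControl t₀) (t : ℝ) :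
    Prop :=
  ∀ k, d.time k ≤ t ∨ e.time k ≤ t → d.time k = e.time k ∧ d.impulse k = e.impulse k

/-- Non-anticipative strategies of the minimizer. -/
def Strategy (D : ImpulseGame m) (t₀ : ℝ) : Type :=
  {φ : D.Control → D.ImpulseControl t₀ //
    ∀ τ₁ τ₂ : D.Control, ∀ t ∈ Icc t₀ D.T,
      (∀ s ∈ Ico t₀ t, τ₁.1 s = τ₂.1 s) → (φ τ₁).AgreeUpTo (φ τ₂) t}

open Classical in
/-- `y` is the (left-continuous) trajectory on `[t₀, T]` issued from `x` under the controls
`τ` and `d`, and `z k` is the state immediately before the `k`-th jump. Thus `z k = y (t_k)`,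
unless the `k`-th jump is preceded by other jumps at the same instant, in which case `z k` is the
state reached after these. The ODE is understood in the Carathéodory (integral) sense. -/
structure IsTrajectory (D : ImpulseGame m) (t₀ : ℝ) (x : StateSpace m) (τ : D.Control)
    (d : D.ImpulseControl t₀) (y : ℝ → StateSpace m) (z : ℕ → StateSpace m) : Prop where
  integrable : IntervalIntegrable (fun s => D.f s (y s) (τ.1 s)) volume t₀ D.T
  state : ∀ t ∈ Icc t₀ D.T, y t = x + (∫ s in t₀..t, D.f s (y s) (τ.1 s))
    + ∑ j ∈ d.jumps with d.time j < t, D.g (d.time j) (z j) (d.impulse j)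
  preJump : ∀ k ∈ d.jumps, z k = x + (∫ s in t₀..(d.time k), D.f s (y s) (τ.1 s))
    + ∑ j ∈ Finset.range k, D.g (d.time j) (z j) (d.impulse j)

/-- The state at time `T`, after the jumps that take place at time `T`, if any. -/
def finalState (D : ImpulseGame m) (t₀ : ℝ) (x : StateSpace m) (τ : D.Control)
    (d : D.ImpulseControl t₀) (y : ℝ → StateSpace m) (z : ℕ → StateSpace m) : StateSpace m :=
  x + (∫ s in t₀..D.T, D.f s (y s) (τ.1 s))
    + ∑ j ∈ d.jumps, D.g (d.time j) (z j) (d.impulse j)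

/-- The pay-off of a trajectory. -/
def payoff (D : ImpulseGame m) (t₀ : ℝ) (x : StateSpace m) (τ : D.Control)
    (d : D.ImpulseControl t₀) (y : ℝ → StateSpace m) (z : ℕ → StateSpace m) : ℝ :=
  (∫ s in t₀..D.T, D.ψ s (y s) (τ.1 s))
    + ∑ k ∈ d.jumps, D.C (d.time k) (z k) (d.impulse k)
    + D.G (D.finalState t₀ x τ d y z)

/-- The value function, infimum over non-anticipative strategies of the supremum over controls of
the pay-off, as an extended real number. The trajectory is determined by the controls, so that the
inner supremum over `y` and `z` is the pay-off of that trajectory. -/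
def value (D : ImpulseGame m) (t₀ : ℝ) (x : StateSpace m) : EReal :=
  ⨅ φ : D.Strategy t₀, ⨆ (τ : D.Control) (y : ℝ → StateSpace m) (z : ℕ → StateSpace m)
    (_ : D.IsTrajectory t₀ x τ (φ.1 τ) y z), (D.payoff t₀ x τ (φ.1 τ) y z : EReal)

/-- The state `x + g(t, x, ξ)` reached after the successive jumps `ξ = [ξ₁, …, ξₙ]` at the
instant `t`. -/
def afterJumps (D : ImpulseGame m) (t : ℝ) : StateSpace m → List (StateSpace m) → StateSpace m
  | x, [] => x
  | x, ξ :: l => D.afterJumps t (x + D.g t x ξ) l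

/-- The total cost `C(t, x, ξ)` of the successive jumps `ξ = [ξ₁, …, ξₙ]` at the instant `t`. -/
def jumpsCost (D : ImpulseGame m) (t : ℝ) : StateSpace m → List (StateSpace m) → ℝ
  | _, [] => 0
  | x, ξ :: l => D.C t x ξ + D.jumpsCost t (x + D.g t x ξ) l

/-- Finite nonempty sequences of (nonzero) impulses, of length at most `κ (1 + |x|)`;
for `κ = ∞` the length is not restricted. -/
def impulseSeqs (κ : ℝ≥0∞) (x : StateSpace m) : Set (List (StateSpace m)) :=
  {l | l ≠ [] ∧ (∀ ξ ∈ l, ξ ≠ 0) ∧ (l.length : ℝ≥0∞) ≤ κ * ENNReal.ofReal (1 + ‖x‖)}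

/-- The intervention operator `N[v]`, with values in the extended reals. -/
def interv (D : ImpulseGame m) (κ : ℝ≥0∞) (v : ℝ → StateSpace m → ℝ) (t : ℝ)
    (x : StateSpace m) : EReal :=
  ⨅ l ∈ impulseSeqs κ x, ((v t (D.afterJumps t x l) + D.jumpsCost t x l : ℝ) : EReal)

/-- The terminal value `G₁ = min {G, N[G](T, ·)}`. -/
def terminalValue (D : ImpulseGame m) (κ : ℝ≥0∞) (x : StateSpace m) : EReal :=
  min (D.G x : EReal) (D.interv κ (fun _ => D.G) D.T x)

/-- `φ` is of class `C^{1,2}` on `[t₀, T) × ℝ^m`, with time derivative `φt`, gradient `φx` and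
second space derivative `φxx` (the time derivative at `t₀` is one-sided). -/
structure IsC12 (t₀ T : ℝ) (φ φt : ℝ → StateSpace m → ℝ)
    (φx : ℝ → StateSpace m → StateSpace m →L[ℝ] ℝ)
    (φxx : ℝ → StateSpace m → StateSpace m →L[ℝ] StateSpace m →L[ℝ] ℝ) : Prop where
  hasDeriv_t : ∀ t ∈ Ico t₀ T, ∀ x,
    HasDerivWithinAt (fun s => φ s x) (φt t x) (Ico t₀ T) t
  hasDeriv_x : ∀ t ∈ Ico t₀ T, ∀ x, HasFDerivAt (φ t) (φx t x) x
  hasDeriv_xx : ∀ t ∈ Ico t₀ T, ∀ x, HasFDerivAt (φx t) (φxx t x) x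
  cont : ContinuousOn (fun p : ℝ × StateSpace m => φ p.1 p.2) (Ico t₀ T ×ˢ univ)
  cont_t : ContinuousOn (fun p : ℝ × StateSpace m => φt p.1 p.2) (Ico t₀ T ×ˢ univ)
  cont_x : ContinuousOn (fun p : ℝ × StateSpace m => φx p.1 p.2) (Ico t₀ T ×ˢ univ)
  cont_xx : ContinuousOn (fun p : ℝ × StateSpace m => φxx p.1 p.2) (Ico t₀ T ×ˢ univ)

/-- The left-hand side `max {min_τ [-a - p · f(t,x,τ) - ψ(t,x,τ)], v(t,x) - N[v](t,x)}` of the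
quasi-variational inequality, where `a` and `p` stand for the time and space derivatives. -/
def qvi (D : ImpulseGame m) (κ : ℝ≥0∞) (v : ℝ → StateSpace m → ℝ) (t : ℝ) (x : StateSpace m)
    (a : ℝ) (p : StateSpace m →L[ℝ] ℝ) : EReal :=
  max (⨅ τ ∈ D.K, ((-a - p (D.f t x τ) - D.ψ t x τ : ℝ) : EReal))
    ((v t x : EReal) - D.interv κ v t x)

/-- Viscosity supersolution on `[t₀, T) × ℝ^m`. -/
def IsViscositySupersolution (D : ImpulseGame m) (κ : ℝ≥0∞) (t₀ : ℝ)
    (v : ℝ → StateSpace m → ℝ) : Prop :=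
  ∀ t ∈ Ico t₀ D.T, ∀ x, ∀ φ φt φx φxx, IsC12 t₀ D.T φ φt φx φxx → φ t x = v t x →
    IsLocalMaxOn (fun q : ℝ × StateSpace m => φ q.1 q.2 - v q.1 q.2)
      (Ico t₀ D.T ×ˢ univ) (t, x) →
    0 ≤ D.qvi κ v t x (φt t x) (φx t x)

/-- Viscosity subsolution on `[t₀, T) × ℝ^m`. -/
def IsViscositySubsolution (D : ImpulseGame m) (κ : ℝ≥0∞) (t₀ : ℝ)
    (v : ℝ → StateSpace m → ℝ) : Prop :=
  ∀ t ∈ Ico t₀ D.T, ∀ x, ∀ φ φt φx φxx, IsC12 t₀ D.T φ φt φx φxx → φ t x = v t x →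
    IsLocalMinOn (fun q : ℝ × StateSpace m => φ q.1 q.2 - v q.1 q.2)
      (Ico t₀ D.T ×ˢ univ) (t, x) →
    D.qvi κ v t x (φt t x) (φx t x) ≤ 0

/-- Viscosity solution: a continuous function on `[0, T] × ℝ^m` with terminal value `G₁` which is
both a supersolution and a subsolution. -/
structure IsViscositySolution (D : ImpulseGame m) (κ : ℝ≥0∞) (t₀ : ℝ)
    (v : ℝ → StateSpace m → ℝ) : Prop where
  continuousOn : ContinuousOn (fun p : ℝ × StateSpace m => v p.1 p.2) (Icc 0 D.T ×ˢ univ)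
  terminal : ∀ x, (v D.T x : EReal) = D.terminalValue κ x
  supersolution : D.IsViscositySupersolution κ t₀ v
  subsolution : D.IsViscositySubsolution κ t₀ v

end ImpulseGame

end

/-! Two dynamic programming inequalities hold for the value function; together with its continuity
they give the viscosity inequalities.

Between jumps the state follows the flow of a Carathéodory equation. Cutting a trajectory at its
jumps shows that it exists, and that its pay-off is the recursive quantity `pay` determined by the
controls alone (`exists_isJumpTrajectory`, `IsJumpTrajectory.payoff_eq`). The value is therefore an
inf-sup of `outcome` (`value_eq`).

Each jump costs at least `α`, the other costs are bounded below, and never jumping has a cost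
bounded on bounded sets of states. So responses that are optimal up to 1 make boundedly many jumps,
locally uniformly (`exists_num_le`). For a bounded number of jumps, `pay` depends uniformly
continuously on the initial time and state, provided that jumps before the later initial time are
postponed to it (`pay_near`). Carrying near-optimal strategies from one initial point to another
then yields continuity (`val_near`).

The upper inequalities come from constructing strategies: jump at once (`val_le_jumps`), or wait and
then play nearly optimally from the state reached (`val_le_of_forall_run`). The lower one,
`first_jump_or_run_le`, rests on non-anticipativity: up to and including its first jump, a strategy
cannot react to what the maximizer does afterwards, so its continuation is again a strategy and
costs at least the value. Comparison with the expansion of a test function along the flow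
(`IsC12.expansion_flow`) gives both viscosity inequalities. The constant `κ₀` serves two purposes:
single jumps must be allowed in `N`, and at time `T` longer sequences must cost more than not
jumping. -/

/-! ### Grönwall's inequality and Carathéodory integral equations -/

/-- Integral form of Grönwall's inequality. -/
theorem le_mul_exp_of_le_add_mul_integral {u : ℝ → ℝ} {a b δ K : ℝ} (hK : 0 ≤ K)
    (hu : ContinuousOn u (Icc a b))
    (h : ∀ s ∈ Icc a b, u s ≤ δ + K * ∫ r in a..s, u r) :
    ∀ s ∈ Icc a b, u s ≤ δ * Real.exp (K * (s - a)) := by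
  intro s hs
  have hab : a ≤ b := hs.1.trans hs.2
  -- A continuous extension of `u` to the line makes the primitive differentiable at every point,
  -- endpoints included.
  set w : ℝ → ℝ := IccExtend hab ((Icc a b).domRestrict u) with hw
  have hwc : Continuous w := (continuousOn_iff_continuous_domRestrict.1 hu).Icc_extend'
  have hwu : ∀ r ∈ Icc a b, w r = u r := fun r hr => by
    rw [hw, IccExtend_of_mem hab _ hr]; rfl
  have hd : ∀ r, HasDerivAt (fun s => δ + K * ∫ r in a..s, w r) (K * w r) r := fun r =>
    ((hwc.integral_hasStrictDerivAt a r).hasDerivAt.const_mul K).const_add δ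
  have hI : ∀ s ∈ Icc a b, ∫ r in a..s, w r = ∫ r in a..s, u r := fun s hs =>
    intervalIntegral.integral_congr fun r hr => by
      rw [uIcc_of_le hs.1] at hr
      exact hwu r ⟨hr.1, hr.2.trans hs.2⟩
  -- The differential form is applied to the right-hand side of `h`, whose derivative `K * u` is at
  -- most `K` times itself.
  have key := le_gronwallBound_of_liminf_deriv_right_le (f := fun s => δ + K * ∫ r in a..s, w r)
    (f' := fun r => K * w r) (δ := δ) (K := K) (ε := 0) (a := a) (b := b)
    (fun r _ => (hd r).continuousAt.continuousWithinAt)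
    (fun r _ q hq => (hd r).hasDerivWithinAt.liminf_right_slope_le hq)
    (by simp)
    (fun r hr => by
      have h1 := h r (Ico_subset_Icc_self hr)
      rw [← hI r (Ico_subset_Icc_self hr), ← hwu r (Ico_subset_Icc_self hr)] at h1
      have := mul_le_mul_of_nonneg_left h1 hK
      linarith) s hs
  rw [gronwallBound_ε0] at key
  have h1 := h s hs
  rw [← hI s hs] at h1
  exact h1.trans key

section Caratheodory

variable {E : Type*} [NormedAddCommGroup E] [NormedSpace ℝ E]

/-- Continuous dependence of solutions of an integral equation on the initial value. -/
theorem norm_sub_le_of_integral_eq {F : ℝ → E → E} {a b K : ℝ} (hK : 0 ≤ K) {x x' : E}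
    {u w : ℝ → E} (hF : ∀ r ∈ Icc a b, ∀ p q, ‖F r p - F r q‖ ≤ K * ‖p - q‖)
    (hu : ContinuousOn u (Icc a b)) (hw : ContinuousOn w (Icc a b))
    (hui : IntervalIntegrable (fun r => F r (u r)) volume a b)
    (hwi : IntervalIntegrable (fun r => F r (w r)) volume a b)
    (hue : ∀ s ∈ Icc a b, u s = x + ∫ r in a..s, F r (u r))
    (hwe : ∀ s ∈ Icc a b, w s = x' + ∫ r in a..s, F r (w r)) :
    ∀ s ∈ Icc a b, ‖u s - w s‖ ≤ ‖x - x'‖ * Real.exp (K * (s - a)) := by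
  refine le_mul_exp_of_le_add_mul_integral hK (hu.sub hw).norm fun s hs => ?_
  have hsub : uIcc a s ⊆ uIcc a b := by
    rw [uIcc_of_le hs.1, uIcc_of_le (hs.1.trans hs.2)]
    exact Icc_subset_Icc_right hs.2
  have hus := hui.mono_set hsub
  have hws := hwi.mono_set hsub
  have e : u s - w s = (x - x') + ∫ r in a..s, (F r (u r) - F r (w r)) := by
    rw [intervalIntegral.integral_sub hus hws, hue s hs, hwe s hs]; abel
  have hc : IntervalIntegrable (fun r => K * ‖u r - w r‖) volume a s := by
    refine ContinuousOn.intervalIntegrable ?_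
    rw [uIcc_of_le hs.1]
    exact (continuousOn_const.mul (hu.sub hw).norm).mono (Icc_subset_Icc_right hs.2)
  rw [e, ← intervalIntegral.integral_const_mul]
  refine (norm_add_le _ _).trans (add_le_add le_rfl ?_)
  refine intervalIntegral.norm_integral_le_of_norm_le hs.1 (ae_of_all _ fun r hr => ?_) hc
  exact hF r ⟨hr.1.le, hr.2.trans hs.2⟩ _ _

/-- Carathéodory existence theorem under a global Lipschitz condition. -/
theorem exists_integral_eq [CompleteSpace E] {F : ℝ → E → E} {a b K : ℝ} (hab : a ≤ b)
    (hK : 0 ≤ K)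
    (hF : ∀ r ∈ Icc a b, ∀ p q, ‖F r p - F r q‖ ≤ K * ‖p - q‖)
    (hi : ∀ Y : ℝ → E, Continuous Y → IntervalIntegrable (fun r => F r (Y r)) volume a b)
    (x : E) :
    ∃ Y : ℝ → E, Continuous Y ∧ ∀ s ∈ Icc a b, Y s = x + ∫ r in a..s, F r (Y r) := by
  have hext : ∀ α : C(Icc a b, E), Continuous (IccExtend hab α) := fun α => α.continuous.Icc_extend'
  have hsub : ∀ s ∈ Icc a b, uIcc a s ⊆ uIcc a b := fun s hs => by
    rw [uIcc_of_le hs.1, uIcc_of_le hab]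
    exact Icc_subset_Icc_right hs.2
  have hcont : ∀ α : C(Icc a b, E), Continuous fun s : Icc a b =>
      x + ∫ r in a..(s : ℝ), F r (IccExtend hab α r) := fun α => by
    have h1 := intervalIntegral.continuousOn_primitive_interval' (hi _ (hext α)) left_mem_uIcc
    rw [uIcc_of_le hab] at h1
    exact continuous_const.add (continuousOn_iff_continuous_domRestrict.1 h1)
  let P : C(Icc a b, E) → C(Icc a b, E) := fun α => ⟨_, hcont α⟩
  have hP : ∀ α s, P α s = x + ∫ r in a..(s : ℝ), F r (IccExtend hab α r) := fun _ _ => rfl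
  -- The factorial in this bound on the Picard iterates makes some iterate a contraction on the
  -- whole interval, however long; its fixed point is also fixed by `P`.
  have hiter : ∀ (n : ℕ) (α β : C(Icc a b, E)) (s : Icc a b),
      dist (P^[n] α s) (P^[n] β s) ≤ (K * (s - a)) ^ n / n.factorial * dist α β := by
    intro n
    induction n with
    | zero => intro α β s; simpa using ContinuousMap.dist_apply_le_dist s
    | succ n ih =>
      intro α β s
      rw [Function.iterate_succ_apply', Function.iterate_succ_apply', hP, hP, dist_add_left,
        dist_eq_norm, ← intervalIntegral.integral_sub
          ((hi _ (hext _)).mono_set (hsub s s.2)) ((hi _ (hext _)).mono_set (hsub s s.2))]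
      have h2 : ∫ r in a..(s : ℝ), K * ((K * (r - a)) ^ n / n.factorial * dist α β)
          = (K * (s - a)) ^ (n + 1) / (n + 1).factorial * dist α β := by
        have : ∀ r, K * ((K * (r - a)) ^ n / n.factorial * dist α β)
            = (K ^ (n + 1) / n.factorial * dist α β) * (r - a) ^ n := fun r => by
          rw [mul_pow]; ring
        simp_rw [this]
        rw [intervalIntegral.integral_const_mul,
          intervalIntegral.integral_comp_sub_right (fun r => r ^ n) a, integral_pow,
          Nat.factorial_succ, mul_pow]
        have : (n.factorial : ℝ) ≠ 0 := by positivity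
        push_cast
        field_simp
        simp
      rw [← h2]
      refine intervalIntegral.norm_integral_le_of_norm_le s.2.1 (ae_of_all _ fun r hr => ?_)
        (Continuous.intervalIntegrable (by fun_prop) _ _)
      have hr' : r ∈ Icc a b := ⟨hr.1.le, hr.2.trans s.2.2⟩
      refine (hF r hr' _ _).trans (mul_le_mul_of_nonneg_left ?_ hK)
      rw [IccExtend_of_mem hab _ hr', IccExtend_of_mem hab _ hr', ← dist_eq_norm]
      exact ih α β ⟨r, hr'⟩
  obtain ⟨n, hn⟩ : ∃ n : ℕ, (K * (b - a)) ^ n / n.factorial < 1 / 2 :=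
    ((FloorSemiring.tendsto_pow_div_factorial_atTop (K * (b - a))).eventually_lt_const
      (by norm_num)).exists
  have hKab : 0 ≤ K * (b - a) := mul_nonneg hK (sub_nonneg.2 hab)
  have hcon : ContractingWith (1 / 2 : ℝ≥0) P^[n] := by
    refine ⟨by rw [← NNReal.coe_lt_coe]; norm_num, LipschitzWith.of_dist_le_mul fun α β => ?_⟩
    rw [ContinuousMap.dist_le (by positivity)]
    intro s
    refine (hiter n α β s).trans (mul_le_mul_of_nonneg_right ?_ dist_nonneg)
    have h1 : (K * ((s : ℝ) - a)) ^ n / n.factorial ≤ (K * (b - a)) ^ n / n.factorial := by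
      have : 0 ≤ K * ((s : ℝ) - a) := mul_nonneg hK (sub_nonneg.2 s.2.1)
      have h3 := s.2.2
      gcongr
    push_cast
    linarith
  have hfix := hcon.isFixedPt_fixedPoint_iterate
  set α := ContractingWith.fixedPoint P^[n] hcon
  refine ⟨IccExtend hab α, hext α, fun s hs => ?_⟩
  conv_lhs => rw [IccExtend_of_mem hab _ hs, ← hfix.eq, hP]

end Caratheodory

noncomputable section

namespace ImpulseGame

variable {m : ℕ}

/-! ### Common constants and integrability along controls -/

/-- Growth, Lipschitz and lower bounds for all the data with a common constant. -/
structure Bounds (D : ImpulseGame m) (c : ℝ) : Prop where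
  nonneg : 0 ≤ c
  f_growth : ∀ t ∈ Icc 0 D.T, ∀ x, ∀ τ ∈ D.K, ‖D.f t x τ‖ ≤ c * (1 + ‖x‖)
  f_lip : ∀ t ∈ Icc 0 D.T, ∀ τ ∈ D.K, ∀ x x', ‖D.f t x τ - D.f t x' τ‖ ≤ c * ‖x - x'‖
  g_growth : ∀ t ∈ Icc 0 D.T, ∀ x ξ, ‖D.g t x ξ‖ ≤ c * (1 + ‖x‖)
  g_lip : ∀ t ∈ Icc 0 D.T, ∀ ξ x x', ‖D.g t x ξ - D.g t x' ξ‖ ≤ c * ‖x - x'‖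
  ψ_growth : ∀ t ∈ Icc 0 D.T, ∀ x, ∀ τ ∈ D.K, |D.ψ t x τ| ≤ c * (1 + ‖x‖)
  ψ_lower : ∀ t ∈ Icc 0 D.T, ∀ x, ∀ τ ∈ D.K, -c ≤ D.ψ t x τ
  G_growth : ∀ x, |D.G x| ≤ c * (1 + ‖x‖)
  G_lower : ∀ x, -c ≤ D.G x

variable {D : ImpulseGame m}

theorem Standing.exists_bounds (hD : D.Standing) : ∃ c, D.Bounds c := by
  obtain ⟨c₁, h₁, h⟩ := hD.growth_lipschitz
  obtain ⟨c₂, h₂⟩ := hD.ψ_growth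
  obtain ⟨b₂, hb₂⟩ := hD.ψ_lower
  obtain ⟨c₃, h₃⟩ := hD.G_growth
  obtain ⟨b₃, hb₃⟩ := hD.G_lower
  -- The bounds on `g` are assumed jointly with those on `f` for controls in `K`, so a point of `K`
  -- is needed to extract them.
  obtain ⟨τ₀, hτ₀⟩ := hD.K_nonempty
  set c := c₁ + |c₂| + |b₂| + |c₃| + |b₃| with hc
  have e1 := abs_nonneg c₂
  have e2 := abs_nonneg b₂
  have e3 := abs_nonneg c₃
  have e4 := abs_nonneg b₃
  have e5 := le_abs_self c₂
  have e6 := le_abs_self c₃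
  have e7 := neg_abs_le b₂
  have e8 := neg_abs_le b₃
  have hg : ∀ {k : ℝ} (x : StateSpace m), k ≤ c → k * (1 + ‖x‖) ≤ c * (1 + ‖x‖) :=
    fun x hk => mul_le_mul_of_nonneg_right hk (by positivity)
  have hl : ∀ {k : ℝ} (x : StateSpace m), k ≤ c → k * ‖x‖ ≤ c * ‖x‖ :=
    fun x hk => mul_le_mul_of_nonneg_right hk (by positivity)
  refine ⟨c, by linarith, fun t ht x τ hτ => ?_, fun t ht τ hτ x x' => ?_, fun t ht x ξ => ?_,
    fun t ht ξ x x' => ?_, fun t ht x τ hτ => ?_, fun t ht x τ hτ => ?_, fun x => ?_,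
    fun x => ?_⟩
  · have := (h t ht τ hτ 0 x x).1
    have := norm_nonneg (D.g t x 0)
    linarith [hg x (show c₁ ≤ c by linarith)]
  · have := (h t ht τ hτ 0 x x').2
    have := norm_nonneg (D.g t x 0 - D.g t x' 0)
    linarith [hl (x - x') (show c₁ ≤ c by linarith)]
  · have := (h t ht τ₀ hτ₀ ξ x x).1
    have := norm_nonneg (D.f t x τ₀)
    linarith [hg x (show c₁ ≤ c by linarith)]
  · have := (h t ht τ₀ hτ₀ ξ x x').2
    have := norm_nonneg (D.f t x τ₀ - D.f t x' τ₀)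
    linarith [hl (x - x') (show c₁ ≤ c by linarith)]
  · linarith [h₂ t ht x τ hτ, hg x (show c₂ ≤ c by linarith)]
  · linarith [hb₂ t ht x τ hτ]
  · linarith [h₃ x, hg x (show c₃ ≤ c by linarith)]
  · linarith [hb₃ x]

/-- On `[a, b]` the argument of `H` is a measurable map into a compact product on which `H` is
continuous, so the integrand is measurable and bounded. The clamped map `q` is used because it stays
in that product at all times. -/
theorem Control.intervalIntegrable_comp (hK : IsCompact D.K) {E : Type*} [NormedAddCommGroup E]
    [SecondCountableTopology E] [MeasurableSpace E] [BorelSpace E] [NormedSpace ℝ E]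
    {H : ℝ × StateSpace m × StateSpace m → E}
    (hH : ContinuousOn H (Icc 0 D.T ×ˢ (univ ×ˢ D.K))) (τ : D.Control) {a b : ℝ}
    (h0 : 0 ≤ a) (hab : a ≤ b) (hb : b ≤ D.T) {Y : ℝ → StateSpace m}
    (hY : ContinuousOn Y (Icc a b)) :
    IntervalIntegrable (fun r => H (r, Y r, τ.1 r)) volume a b := by
  have hYr : Continuous ((Icc a b).domRestrict Y) := continuousOn_iff_continuous_domRestrict.1 hY
  let q : ℝ → ℝ × StateSpace m × StateSpace m := fun r =>
    ((projIcc a b hab r : ℝ), IccExtend hab ((Icc a b).domRestrict Y) r, τ.1 r)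
  have hqm : Measurable q :=
    ((continuous_subtype_val.comp continuous_projIcc).measurable).prodMk
      (hYr.Icc_extend'.measurable.prodMk τ.2.1)
  have hq : ∀ r, q r ∈ Icc a b ×ˢ ((Y '' Icc a b) ×ˢ D.K) := fun r =>
    ⟨(projIcc a b hab r).2, ⟨_, (projIcc a b hab r).2, rfl⟩, τ.2.2 r⟩
  have hsub : Icc a b ×ˢ ((Y '' Icc a b) ×ˢ D.K) ⊆ Icc 0 D.T ×ˢ (univ ×ˢ D.K) :=
    prod_mono (Icc_subset_Icc h0 hb) (prod_mono (subset_univ _) le_rfl)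
  have hcomp : IsCompact (Icc a b ×ˢ ((Y '' Icc a b) ×ˢ D.K)) :=
    isCompact_Icc.prod ((isCompact_Icc.image_of_continuousOn hY).prod hK)
  obtain ⟨M, hM⟩ := (hcomp.image_of_continuousOn (hH.mono hsub)).isBounded.exists_norm_le
  have hm : Measurable fun r => H (q r) :=
    (continuousOn_iff_continuous_domRestrict.1 (hH.mono hsub)).measurable.comp
      (hqm.subtype_mk (h := hq))
  have hi : IntervalIntegrable (fun r => H (q r)) volume a b := by
    rw [intervalIntegrable_iff]
    exact Measure.integrableOn_of_bounded (M := M) (by simp) hm.aestronglyMeasurable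
      (ae_of_all _ fun r => hM _ ⟨_, hq r, rfl⟩)
  refine hi.congr fun r hr => ?_
  rw [uIoc_of_le hab] at hr
  have hr' : r ∈ Icc a b := Ioc_subset_Icc_self hr
  simp only [q, IccExtend_of_mem hab _ hr', projIcc_of_mem hab hr', domRestrict_apply]

theorem Standing.intervalIntegrable_f (hD : D.Standing) (τ : D.Control) {a b : ℝ}
    (h0 : 0 ≤ a) (hab : a ≤ b) (hb : b ≤ D.T) {Y : ℝ → StateSpace m}
    (hY : ContinuousOn Y (Icc a b)) :
    IntervalIntegrable (fun r => D.f r (Y r) (τ.1 r)) volume a b :=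
  Control.intervalIntegrable_comp hD.K_compact hD.f_cont τ h0 hab hb hY

theorem Standing.intervalIntegrable_ψ (hD : D.Standing) (τ : D.Control) {a b : ℝ}
    (h0 : 0 ≤ a) (hab : a ≤ b) (hb : b ≤ D.T) {Y : ℝ → StateSpace m}
    (hY : ContinuousOn Y (Icc a b)) :
    IntervalIntegrable (fun r => D.ψ r (Y r) (τ.1 r)) volume a b :=
  Control.intervalIntegrable_comp hD.K_compact hD.ψ_cont τ h0 hab hb hY

/-! ### The flow without jumps and its running cost -/

open Classical in
/-- The trajectory without jumps issued from `x` at time `t`. -/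
def flow (D : ImpulseGame m) (τ : D.Control) (t : ℝ) (x : StateSpace m) : ℝ → StateSpace m :=
  if h : ∃ Y : ℝ → StateSpace m, Continuous Y ∧
      ∀ s ∈ Icc t D.T, Y s = x + ∫ r in t..s, D.f r (Y r) (τ.1 r)
  then h.choose else fun _ => x

/-- The running cost on `[t, s]` of the trajectory without jumps issued from `x` at time `t`. -/
def run (D : ImpulseGame m) (τ : D.Control) (t : ℝ) (x : StateSpace m) (s : ℝ) : ℝ :=
  ∫ r in t..s, D.ψ r (D.flow τ t x r) (τ.1 r)

variable {c : ℝ}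

theorem flow_spec (hD : D.Standing) (hc : D.Bounds c) (τ : D.Control) {t : ℝ}
    (ht : t ∈ Icc 0 D.T) (x : StateSpace m) : Continuous (D.flow τ t x) ∧
    ∀ s ∈ Icc t D.T, D.flow τ t x s = x + ∫ r in t..s, D.f r (D.flow τ t x r) (τ.1 r) := by
  have h : ∃ Y : ℝ → StateSpace m, Continuous Y ∧
      ∀ s ∈ Icc t D.T, Y s = x + ∫ r in t..s, D.f r (Y r) (τ.1 r) :=
    exists_integral_eq (F := fun r y => D.f r y (τ.1 r)) ht.2 hc.nonneg
      (fun r hr => hc.f_lip r ⟨ht.1.trans hr.1, hr.2⟩ _ (τ.2.2 r))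
      (fun Y hY => hD.intervalIntegrable_f τ ht.1 ht.2 le_rfl hY.continuousOn) x
  rw [flow, dif_pos h]
  exact h.choose_spec

theorem continuous_flow (hD : D.Standing) (hc : D.Bounds c) (τ : D.Control) {t : ℝ}
    (ht : t ∈ Icc 0 D.T) (x : StateSpace m) : Continuous (D.flow τ t x) :=
  (flow_spec hD hc τ ht x).1

theorem flow_eq (hD : D.Standing) (hc : D.Bounds c) (τ : D.Control) {t s : ℝ}
    (ht : t ∈ Icc 0 D.T) (x : StateSpace m) (hs : s ∈ Icc t D.T) :
    D.flow τ t x s = x + ∫ r in t..s, D.f r (D.flow τ t x r) (τ.1 r) :=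
  (flow_spec hD hc τ ht x).2 s hs

@[simp]
theorem flow_self (hD : D.Standing) (hc : D.Bounds c) (τ : D.Control) {t : ℝ}
    (ht : t ∈ Icc 0 D.T) (x : StateSpace m) : D.flow τ t x t = x := by
  simpa using flow_eq hD hc τ ht x (left_mem_Icc.2 ht.2)

/-- The end point `b` is negligible; agreement on the half-open interval is exactly what
non-anticipativity supplies. -/
theorem integral_control_congr {E : Type*} [NormedAddCommGroup E] [NormedSpace ℝ E]
    {H : ℝ → StateSpace m → E} {τ τ' : ℝ → StateSpace m} {a b : ℝ} (hab : a ≤ b)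
    (h : ∀ r ∈ Ico a b, τ r = τ' r) :
    ∫ r in a..b, H r (τ r) = ∫ r in a..b, H r (τ' r) := by
  rw [intervalIntegral.integral_of_le hab, intervalIntegral.integral_of_le hab,
    integral_Ioc_eq_integral_Ioo, integral_Ioc_eq_integral_Ioo]
  exact setIntegral_congr_fun measurableSet_Ioo fun r hr => by
    simp only [h r (Ioo_subset_Ico_self hr)]

/-- Grönwall with equal initial values. Allowing a second control that agrees only before `s` gives
both causality (`flow_congr`) and the cocycle property (`flow_flow`). -/
theorem flow_unique (hD : D.Standing) (hc : D.Bounds c) (τ : D.Control) {t s : ℝ}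
    (ht : 0 ≤ t) (hts : t ≤ s) (hs : s ≤ D.T) (x : StateSpace m)
    {u τ' : ℝ → StateSpace m} (hτ : ∀ r ∈ Ico t s, τ' r = τ.1 r) (hu : ContinuousOn u (Icc t s))
    (hue : ∀ r ∈ Icc t s, u r = x + ∫ q in t..r, D.f q (u q) (τ' q)) :
    ∀ r ∈ Icc t s, u r = D.flow τ t x r := by
  intro r hr
  have ht' : t ∈ Icc 0 D.T := ⟨ht, hts.trans hs⟩
  have h := norm_sub_le_of_integral_eq (F := fun q y => D.f q y (τ.1 q)) (a := t) (b := s)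
    (K := c) (x := x) (x' := x) (u := u) (w := D.flow τ t x) hc.nonneg
    (fun q hq => hc.f_lip q ⟨ht.trans hq.1, hq.2.trans hs⟩ _ (τ.2.2 q)) hu
    (continuous_flow hD hc τ ht' x).continuousOn (hD.intervalIntegrable_f τ ht hts hs hu)
    (hD.intervalIntegrable_f τ ht hts hs (continuous_flow hD hc τ ht' x).continuousOn)
    (fun q hq => by
      rw [hue q hq]
      congr 1
      exact integral_control_congr (H := fun q e => D.f q (u q) e) hq.1
        fun p hp => hτ p ⟨hp.1, hp.2.trans_le hq.2⟩)
    (fun q hq => flow_eq hD hc τ ht' x ⟨hq.1, hq.2.trans hs⟩) r hr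
  rw [sub_self, norm_zero, zero_mul] at h
  exact sub_eq_zero.1 (norm_le_zero_iff.1 h)

theorem flow_congr (hD : D.Standing) (hc : D.Bounds c) {τ τ' : D.Control} {t s : ℝ}
    (ht : 0 ≤ t) (hts : t ≤ s) (hs : s ≤ D.T) (x : StateSpace m)
    (hτ : ∀ r ∈ Ico t s, τ'.1 r = τ.1 r) :
    ∀ r ∈ Icc t s, D.flow τ' t x r = D.flow τ t x r :=
  flow_unique hD hc τ ht hts hs x hτ
    (continuous_flow hD hc τ' ⟨ht, hts.trans hs⟩ x).continuousOn
    fun _ hr => flow_eq hD hc τ' ⟨ht, hts.trans hs⟩ x ⟨hr.1, hr.2.trans hs⟩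

theorem flow_flow (hD : D.Standing) (hc : D.Bounds c) (τ : D.Control) {t s : ℝ}
    (ht : 0 ≤ t) (hts : t ≤ s) (hs : s ≤ D.T) (x : StateSpace m) :
    ∀ r ∈ Icc s D.T, D.flow τ t x r = D.flow τ s (D.flow τ t x s) r := by
  have ht' : t ∈ Icc 0 D.T := ⟨ht, hts.trans hs⟩
  have hY := continuous_flow hD hc τ ht' x
  refine flow_unique hD hc τ (ht.trans hts) hs le_rfl _ (fun _ _ => rfl) hY.continuousOn
    fun r hr => ?_
  rw [flow_eq hD hc τ ht' x ⟨hts, hs⟩, flow_eq hD hc τ ht' x ⟨hts.trans hr.1, hr.2⟩, add_assoc,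
    intervalIntegral.integral_add_adjacent_intervals
      (hD.intervalIntegrable_f τ ht hts hs hY.continuousOn)
      (hD.intervalIntegrable_f τ (ht.trans hts) hr.1 hr.2 hY.continuousOn)]

theorem one_add_norm_flow_le (hD : D.Standing) (hc : D.Bounds c) (τ : D.Control) {t s : ℝ}
    (ht : t ∈ Icc 0 D.T) (x : StateSpace m) (hs : s ∈ Icc t D.T) :
    1 + ‖D.flow τ t x s‖ ≤ (1 + ‖x‖) * Real.exp (c * D.T) := by
  have hY := continuous_flow hD hc τ ht x
  have h := le_mul_exp_of_le_add_mul_integral (u := fun r => 1 + ‖D.flow τ t x r‖) (a := t)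
    (b := D.T) (δ := 1 + ‖x‖) (K := c) hc.nonneg (by fun_prop) (fun q hq => ?_) s hs
  · refine h.trans (mul_le_mul_of_nonneg_left (Real.exp_le_exp.2 ?_) (by positivity))
    exact mul_le_mul_of_nonneg_left (by linarith [hs.2, ht.1]) hc.nonneg
  · rw [flow_eq hD hc τ ht x hq, add_assoc, ← intervalIntegral.integral_const_mul]
    refine add_le_add le_rfl ((norm_add_le _ _).trans (add_le_add le_rfl ?_))
    refine intervalIntegral.norm_integral_le_of_norm_le hq.1 (ae_of_all _ fun r hr => ?_)
      (Continuous.intervalIntegrable (by fun_prop) _ _)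
    exact hc.f_growth r ⟨ht.1.trans hr.1.le, hr.2.trans hq.2⟩ _ _ (τ.2.2 r)

theorem norm_flow_sub_le (hD : D.Standing) (hc : D.Bounds c) (τ : D.Control) {t s : ℝ}
    (ht : t ∈ Icc 0 D.T) (x : StateSpace m) (hs : s ∈ Icc t D.T) :
    ‖D.flow τ t x s - x‖ ≤ c * ((1 + ‖x‖) * Real.exp (c * D.T)) * (s - t) := by
  rw [flow_eq hD hc τ ht x hs, add_sub_cancel_left]
  refine (intervalIntegral.norm_integral_le_of_norm_le_const fun r hr => ?_).trans_eq
    (by rw [abs_of_nonneg (sub_nonneg.2 hs.1)])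
  rw [uIoc_of_le hs.1] at hr
  have hr' : r ∈ Icc t D.T := ⟨hr.1.le, hr.2.trans hs.2⟩
  exact (hc.f_growth r ⟨ht.1.trans hr'.1, hr'.2⟩ _ _ (τ.2.2 r)).trans
    (mul_le_mul_of_nonneg_left (one_add_norm_flow_le hD hc τ ht x hr') hc.nonneg)

theorem norm_flow_sub_flow_le (hD : D.Standing) (hc : D.Bounds c) (τ : D.Control) {t s : ℝ}
    (ht : t ∈ Icc 0 D.T) (x x' : StateSpace m) (hs : s ∈ Icc t D.T) :
    ‖D.flow τ t x s - D.flow τ t x' s‖ ≤ ‖x - x'‖ * Real.exp (c * D.T) := by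
  have h := norm_sub_le_of_integral_eq (F := fun q y => D.f q y (τ.1 q)) (a := t) (b := D.T)
    (K := c) (x := x) (x' := x') (u := D.flow τ t x) (w := D.flow τ t x') hc.nonneg
    (fun q hq => hc.f_lip q ⟨ht.1.trans hq.1, hq.2⟩ _ (τ.2.2 q))
    (continuous_flow hD hc τ ht x).continuousOn (continuous_flow hD hc τ ht x').continuousOn
    (hD.intervalIntegrable_f τ ht.1 ht.2 le_rfl (continuous_flow hD hc τ ht x).continuousOn)
    (hD.intervalIntegrable_f τ ht.1 ht.2 le_rfl (continuous_flow hD hc τ ht x').continuousOn)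
    (fun q hq => flow_eq hD hc τ ht x hq) (fun q hq => flow_eq hD hc τ ht x' hq) s hs
  refine h.trans (mul_le_mul_of_nonneg_left (Real.exp_le_exp.2 ?_) (norm_nonneg _))
  exact mul_le_mul_of_nonneg_left (by linarith [hs.2, ht.1]) hc.nonneg

theorem intervalIntegrable_ψ_flow (hD : D.Standing) (hc : D.Bounds c) (τ : D.Control) {t a b : ℝ}
    (ht : t ∈ Icc 0 D.T) (x : StateSpace m) (ha : 0 ≤ a) (hab : a ≤ b) (hb : b ≤ D.T) :
    IntervalIntegrable (fun r => D.ψ r (D.flow τ t x r) (τ.1 r)) volume a b :=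
  hD.intervalIntegrable_ψ τ ha hab hb (continuous_flow hD hc τ ht x).continuousOn

@[simp]
theorem run_self (τ : D.Control) (t : ℝ) (x : StateSpace m) : D.run τ t x t = 0 := by
  simp [run]

theorem run_add_run (hD : D.Standing) (hc : D.Bounds c) (τ : D.Control) {t s r : ℝ}
    (ht : 0 ≤ t) (hts : t ≤ s) (hsr : s ≤ r) (hr : r ≤ D.T) (x : StateSpace m) :
    D.run τ t x s + D.run τ s (D.flow τ t x s) r = D.run τ t x r := by
  have ht' : t ∈ Icc 0 D.T := ⟨ht, hts.trans (hsr.trans hr)⟩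
  have h : D.run τ s (D.flow τ t x s) r = ∫ q in s..r, D.ψ q (D.flow τ t x q) (τ.1 q) :=
    intervalIntegral.integral_congr fun q hq => by
      rw [uIcc_of_le hsr] at hq
      simp only [← flow_flow hD hc τ ht hts (hsr.trans hr) x q ⟨hq.1, hq.2.trans hr⟩]
  rw [h, run, run, intervalIntegral.integral_add_adjacent_intervals
    (intervalIntegrable_ψ_flow hD hc τ ht' x ht hts (hsr.trans hr))
    (intervalIntegrable_ψ_flow hD hc τ ht' x (ht.trans hts) hsr hr)]

theorem run_congr (hD : D.Standing) (hc : D.Bounds c) {τ τ' : D.Control} {t s : ℝ}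
    (ht : 0 ≤ t) (hts : t ≤ s) (hs : s ≤ D.T) (x : StateSpace m)
    (hτ : ∀ r ∈ Ico t s, τ'.1 r = τ.1 r) : D.run τ' t x s = D.run τ t x s := by
  have h : D.run τ' t x s = ∫ r in t..s, D.ψ r (D.flow τ t x r) (τ'.1 r) :=
    intervalIntegral.integral_congr fun r hr => by
      rw [uIcc_of_le hts] at hr
      simp only [flow_congr hD hc ht hts hs x hτ r hr]
  rw [h]
  exact integral_control_congr (H := fun r e => D.ψ r (D.flow τ t x r) e) hts hτ

theorem le_run (hD : D.Standing) (hc : D.Bounds c) (τ : D.Control) {t s : ℝ}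
    (ht : t ∈ Icc 0 D.T) (x : StateSpace m) (hs : s ∈ Icc t D.T) :
    -c * (s - t) ≤ D.run τ t x s := by
  have h := intervalIntegral.integral_mono_on (a := t) (b := s) (f := fun _ => -c) hs.1
    (by simp) (intervalIntegrable_ψ_flow hD hc τ ht x ht.1 hs.1 hs.2)
    fun r hr => hc.ψ_lower r ⟨ht.1.trans hr.1, hr.2.trans hs.2⟩ _ _ (τ.2.2 r)
  rw [intervalIntegral.integral_const, smul_eq_mul] at h
  rw [run]
  linarith

theorem abs_run_le (hD : D.Standing) (hc : D.Bounds c) (τ : D.Control) {t s : ℝ}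
    (ht : t ∈ Icc 0 D.T) (x : StateSpace m) (hs : s ∈ Icc t D.T) :
    |D.run τ t x s| ≤ c * ((1 + ‖x‖) * Real.exp (c * D.T)) * (s - t) := by
  rw [← Real.norm_eq_abs]
  refine (intervalIntegral.norm_integral_le_of_norm_le_const fun r hr => ?_).trans_eq
    (by rw [abs_of_nonneg (sub_nonneg.2 hs.1)])
  rw [uIoc_of_le hs.1] at hr
  have hr' : r ∈ Icc t D.T := ⟨hr.1.le, hr.2.trans hs.2⟩
  exact (hc.ψ_growth r ⟨ht.1.trans hr'.1, hr'.2⟩ _ _ (τ.2.2 r)).trans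
    (mul_le_mul_of_nonneg_left (one_add_norm_flow_le hD hc τ ht x hr') hc.nonneg)

/-! ### Spliced controls, and trajectories cut at their jumps -/

/-- The control equal to `τ₀` before time `s` and to `τ₁` from time `s` on. -/
def Control.splice (τ₀ : D.Control) (s : ℝ) (τ₁ : D.Control) : D.Control :=
  ⟨fun r => if r < s then τ₀.1 r else τ₁.1 r,
    Measurable.ite measurableSet_Iio τ₀.2.1 τ₁.2.1, fun r => by
      dsimp only
      split_ifs
      exacts [τ₀.2.2 r, τ₁.2.2 r]⟩

theorem Control.splice_of_lt (τ₀ τ₁ : D.Control) {r s : ℝ} (h : r < s) :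
    (τ₀.splice s τ₁).1 r = τ₀.1 r := if_pos h

theorem Control.splice_of_le (τ₀ τ₁ : D.Control) {r s : ℝ} (h : s ≤ r) :
    (τ₀.splice s τ₁).1 r = τ₁.1 r := if_neg h.not_gt

/-- The first `n` of the jump instants `θ` are those, on `[t, T]`, of jumps that take place. -/
structure Admissible (D : ImpulseGame m) (n : ℕ) (t : ℝ) (θ : ℕ → ℝ) : Prop where
  le : ∀ k, t ≤ θ k
  mono : Monotone θ
  le_T : ∀ k < n, θ k ≤ D.T

theorem Admissible.tail {n : ℕ} {t : ℝ} {θ : ℕ → ℝ} (h : D.Admissible (n + 1) t θ) :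
    D.Admissible n (θ 0) (fun k => θ (k + 1)) :=
  ⟨fun _ => h.mono (Nat.zero_le _), fun _ _ hij => h.mono (Nat.succ_le_succ hij),
    fun k hk => h.le_T (k + 1) (by omega)⟩

theorem Admissible.head_mem {n : ℕ} {t : ℝ} {θ : ℕ → ℝ} (h : D.Admissible (n + 1) t θ) :
    θ 0 ∈ Icc t D.T := ⟨h.le 0, h.le_T 0 n.succ_pos⟩

theorem Admissible.mono_left {n : ℕ} {t s : ℝ} {θ : ℕ → ℝ} (h : D.Admissible n s θ)
    (hts : t ≤ s) : D.Admissible n t θ :=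
  ⟨fun k => hts.trans (h.le k), h.mono, h.le_T⟩

/-- The pay-off, from time `t` and state `x` on, under the control `τ` and `n` jumps. -/
def pay (D : ImpulseGame m) (τ : D.Control) :
    ℕ → ℝ → StateSpace m → (ℕ → ℝ) → (ℕ → StateSpace m) → ℝ
  | 0, t, x, _, _ => D.run τ t x D.T + D.G (D.flow τ t x D.T)
  | n + 1, t, x, θ, ξ => D.run τ t x (θ 0) + D.C (θ 0) (D.flow τ t x (θ 0)) (ξ 0) +
      pay D τ n (θ 0) (D.flow τ t x (θ 0) + D.g (θ 0) (D.flow τ t x (θ 0)) (ξ 0))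
        (fun k => θ (k + 1)) (fun k => ξ (k + 1))

/-- Trajectories with jumps at the first `n` of the instants `θ`. -/
structure IsJumpTrajectory (D : ImpulseGame m) (n : ℕ) (t : ℝ) (x : StateSpace m) (τ : D.Control)
    (θ : ℕ → ℝ) (ξ : ℕ → StateSpace m) (y : ℝ → StateSpace m) (z : ℕ → StateSpace m) : Prop where
  integrable : IntervalIntegrable (fun r => D.f r (y r) (τ.1 r)) volume t D.T
  state : ∀ s ∈ Icc t D.T, y s = x + (∫ r in t..s, D.f r (y r) (τ.1 r))
    + ∑ j ∈ Finset.range n, if θ j < s then D.g (θ j) (z j) (ξ j) else 0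
  preJump : ∀ k < n, z k = x + (∫ r in t..(θ k), D.f r (y r) (τ.1 r))
    + ∑ j ∈ Finset.range k, D.g (θ j) (z j) (ξ j)

/-- Intervals open on the left leave the value of `w` at the junction `b` irrelevant, so the second
piece may start from the state after a jump. -/
theorem integral_glue {E : Type*} [NormedAddCommGroup E] [NormedSpace ℝ E] {u v w : ℝ → E}
    {a b d : ℝ} (hab : a ≤ b) (hbd : b ≤ d)
    (hv : IntervalIntegrable v volume a b) (hw : IntervalIntegrable w volume b d)
    (h1 : ∀ r ∈ Ioc a b, u r = v r) (h2 : ∀ r ∈ Ioc b d, u r = w r) :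
    IntervalIntegrable u volume a d ∧
      ∀ s ∈ Icc b d, ∫ r in a..s, u r = (∫ r in a..b, v r) + ∫ r in b..s, w r := by
  have i1 : IntervalIntegrable u volume a b :=
    hv.congr fun r hr => (h1 r (by rwa [uIoc_of_le hab] at hr)).symm
  have i2 : IntervalIntegrable u volume b d :=
    hw.congr fun r hr => (h2 r (by rwa [uIoc_of_le hbd] at hr)).symm
  refine ⟨i1.trans i2, fun s hs => ?_⟩
  have i3 : IntervalIntegrable u volume b s := i2.mono_set (by
    rw [uIcc_of_le hs.1, uIcc_of_le hbd]
    exact Icc_subset_Icc_right hs.2)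
  rw [← intervalIntegral.integral_add_adjacent_intervals i1 i3]
  congr 1
  · rw [intervalIntegral.integral_of_le hab, intervalIntegral.integral_of_le hab]
    exact setIntegral_congr_fun measurableSet_Ioc h1
  · rw [intervalIntegral.integral_of_le hs.1, intervalIntegral.integral_of_le hs.1]
    exact setIntegral_congr_fun measurableSet_Ioc fun r hr => h2 r ⟨hr.1, hr.2.trans hs.2⟩

/-- Induction on the number of jumps: flow up to the first one, then continue with the trajectory
issued from the state after it. -/
theorem exists_isJumpTrajectory (hD : D.Standing) (hc : D.Bounds c) (τ : D.Control) {n : ℕ} :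
    ∀ {t : ℝ} (x : StateSpace m) {θ : ℕ → ℝ} (ξ : ℕ → StateSpace m), t ∈ Icc 0 D.T →
      D.Admissible n t θ → ∃ y z, D.IsJumpTrajectory n t x τ θ ξ y z := by
  induction n with
  | zero =>
    intro t x θ ξ ht _
    refine ⟨D.flow τ t x, 0, hD.intervalIntegrable_f τ ht.1 ht.2 le_rfl
      (continuous_flow hD hc τ ht x).continuousOn, fun s hs => ?_, by simp⟩
    simpa using flow_eq hD hc τ ht x hs
  | succ n ih =>
    intro t x θ ξ ht hθ
    have h0 := hθ.head_mem
    set p := D.flow τ t x (θ 0) with hp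
    obtain ⟨y, z, h⟩ := ih (p + D.g (θ 0) p (ξ 0)) (fun k => ξ (k + 1)) ⟨ht.1.trans h0.1, h0.2⟩
      hθ.tail
    let y' : ℝ → StateSpace m := fun s => if s ≤ θ 0 then D.flow τ t x s else y s
    let z' : ℕ → StateSpace m := fun k => Nat.casesOn k p z
    have hz0 : z' 0 = p := rfl
    have hz1 : ∀ k, z' (k + 1) = z k := fun _ => rfl
    have hadd : ∀ a b d e : StateSpace m, a + b + d + e = a + d + (e + b) :=
      fun a b d e => by abel
    have hy1 : ∀ s ≤ θ 0, y' s = D.flow τ t x s := fun s hs => if_pos hs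
    have hy2 : ∀ s, θ 0 < s → y' s = y s := fun s hs => if_neg hs.not_ge
    obtain ⟨hi, hint⟩ := integral_glue (u := fun r => D.f r (y' r) (τ.1 r)) h0.1 h0.2
      (hD.intervalIntegrable_f τ ht.1 h0.1 h0.2 (continuous_flow hD hc τ ht x).continuousOn)
      h.integrable (fun r hr => by simp only [hy1 r hr.2]) (fun r hr => by simp only [hy2 r hr.1])
    have hint' : ∀ s ∈ Icc (θ 0) D.T, x + ∫ r in t..s, D.f r (y' r) (τ.1 r)
        = p + ∫ r in (θ 0)..s, D.f r (y r) (τ.1 r) := fun s hs => by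
      rw [hint s hs, ← add_assoc, ← flow_eq hD hc τ ht x h0]
    refine ⟨y', z', hi, fun s hs => ?_, fun k hk => ?_⟩
    · rcases le_or_gt s (θ 0) with hsθ | hsθ
      · have e : ∫ r in t..s, D.f r (y' r) (τ.1 r)
            = ∫ r in t..s, D.f r (D.flow τ t x r) (τ.1 r) :=
          intervalIntegral.integral_congr fun r hr => by
            rw [uIcc_of_le hs.1] at hr
            simp only [hy1 r (hr.2.trans hsθ)]
        rw [hy1 s hsθ, e, flow_eq hD hc τ ht x hs, Finset.sum_eq_zero, add_zero]
        exact fun j _ => if_neg (hsθ.trans (hθ.mono (Nat.zero_le j))).not_gt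
      · rw [hy2 s hsθ, h.state s ⟨hsθ.le, hs.2⟩, hint' s ⟨hsθ.le, hs.2⟩,
          Finset.sum_range_succ', if_pos hsθ]
        simp only [hz0, hz1]
        exact hadd _ _ _ _
    · cases k with
      | zero =>
        rw [hint' _ ⟨le_rfl, h0.2⟩]
        simp [hz0]
      | succ k =>
        rw [hint' _ ⟨hθ.mono (Nat.zero_le _), hθ.le_T _ hk⟩, Finset.sum_range_succ']
        simp only [hz0, hz1]
        rw [h.preJump k (by omega)]
        exact hadd _ _ _ _

/-- Uniqueness, by the same induction: before the first jump any trajectory coincides with the flow,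
and what follows is a trajectory with one jump less. -/
theorem IsJumpTrajectory.payoff_eq (hD : D.Standing) (hc : D.Bounds c) (τ : D.Control) {n : ℕ} :
    ∀ {t : ℝ} {x : StateSpace m} {θ : ℕ → ℝ} {ξ : ℕ → StateSpace m} {y : ℝ → StateSpace m}
      {z : ℕ → StateSpace m}, t ∈ Icc 0 D.T → D.Admissible n t θ →
      D.IsJumpTrajectory n t x τ θ ξ y z →
      IntervalIntegrable (fun r => D.ψ r (y r) (τ.1 r)) volume t D.T ∧
      (∫ r in t..D.T, D.ψ r (y r) (τ.1 r)) + ∑ k ∈ Finset.range n, D.C (θ k) (z k) (ξ k)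
        + D.G (x + (∫ r in t..D.T, D.f r (y r) (τ.1 r))
          + ∑ k ∈ Finset.range n, D.g (θ k) (z k) (ξ k)) = D.pay τ n t x θ ξ := by
  have hcont : ∀ {t s : ℝ} {x : StateSpace m} {y : ℝ → StateSpace m}, t ≤ s →
      IntervalIntegrable (fun r => D.f r (y r) (τ.1 r)) volume t s →
      (∀ r ∈ Icc t s, y r = x + ∫ q in t..r, D.f q (y q) (τ.1 q)) → ContinuousOn y (Icc t s) :=
    fun {t s x y} hts hi h => by
      have h1 := intervalIntegral.continuousOn_primitive_interval' hi left_mem_uIcc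
      rw [uIcc_of_le hts] at h1
      exact (continuousOn_const.add h1).congr h
  induction n with
  | zero =>
    intro t x θ ξ y z ht _ h
    have hst : ∀ s ∈ Icc t D.T, y s = x + ∫ r in t..s, D.f r (y r) (τ.1 r) :=
      fun s hs => by simpa using h.state s hs
    have hy := flow_unique hD hc τ ht.1 ht.2 le_rfl x (fun _ _ => rfl)
      (hcont ht.2 h.integrable hst) hst
    have hψ : ∀ r ∈ uIcc t D.T, D.ψ r (y r) (τ.1 r) = D.ψ r (D.flow τ t x r) (τ.1 r) :=
      fun r hr => by
        rw [uIcc_of_le ht.2] at hr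
        rw [hy r hr]
    refine ⟨(intervalIntegrable_ψ_flow hD hc τ ht x ht.1 ht.2 le_rfl).congr
      fun r hr => (hψ r (uIoc_subset_uIcc hr)).symm, ?_⟩
    rw [intervalIntegral.integral_congr hψ]
    have hT := right_mem_Icc.2 ht.2
    simp [pay, run, ← hst _ hT, hy _ hT]
  | succ n ih =>
    intro t x θ ξ y z ht hθ h
    have h0 := hθ.head_mem
    have ht0 : θ 0 ∈ Icc 0 D.T := ⟨ht.1.trans h0.1, h0.2⟩
    have hst : ∀ s ∈ Icc t (θ 0), y s = x + ∫ r in t..s, D.f r (y r) (τ.1 r) := fun s hs => by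
      rw [h.state s ⟨hs.1, hs.2.trans h0.2⟩, Finset.sum_eq_zero, add_zero]
      exact fun j _ => if_neg (hs.2.trans (hθ.mono (Nat.zero_le j))).not_gt
    have hi0 : IntervalIntegrable (fun r => D.f r (y r) (τ.1 r)) volume t (θ 0) :=
      h.integrable.mono_set (by
        rw [uIcc_of_le h0.1, uIcc_of_le ht.2]
        exact Icc_subset_Icc_right h0.2)
    have hi1 : IntervalIntegrable (fun r => D.f r (y r) (τ.1 r)) volume (θ 0) D.T :=
      h.integrable.mono_set (by
        rw [uIcc_of_le h0.2, uIcc_of_le ht.2]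
        exact Icc_subset_Icc_left h0.1)
    have hy := flow_unique hD hc τ ht.1 h0.1 h0.2 x (fun _ _ => rfl) (hcont h0.1 hi0 hst) hst
    set p := D.flow τ t x (θ 0) with hp
    have hz0 : z 0 = p := by
      have := h.preJump 0 n.succ_pos
      rw [Finset.sum_range_zero, add_zero, ← hst _ (right_mem_Icc.2 h0.1),
        hy _ (right_mem_Icc.2 h0.1)] at this
      exact this
    -- By left continuity `y (θ 0)` is the state before the jump, whereas the remaining trajectory
    -- must start from the state after it.
    set y' := Function.update y (θ 0) (p + D.g (θ 0) p (ξ 0)) with hy'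
    have hyy : ∀ r, θ 0 < r → y' r = y r := fun r hr => Function.update_of_ne hr.ne' _ _
    have hi1' : IntervalIntegrable (fun r => D.f r (y' r) (τ.1 r)) volume (θ 0) D.T :=
      hi1.congr fun r hr => by
        rw [uIoc_of_le h0.2] at hr
        simp only [hyy r hr.1]
    obtain ⟨-, hint⟩ := integral_glue (u := fun r => D.f r (y r) (τ.1 r)) h0.1 h0.2
      hi0 hi1' (fun r hr => rfl) (fun r hr => by simp only [hyy r hr.1])
    have hint' : ∀ s ∈ Icc (θ 0) D.T, x + ∫ r in t..s, D.f r (y r) (τ.1 r)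
        = p + ∫ r in (θ 0)..s, D.f r (y' r) (τ.1 r) := fun s hs => by
      rw [hint s hs, ← add_assoc, ← hst _ (right_mem_Icc.2 h0.1), hy _ (right_mem_Icc.2 h0.1)]
    have htail : D.IsJumpTrajectory n (θ 0) (p + D.g (θ 0) p (ξ 0)) τ (fun k => θ (k + 1))
        (fun k => ξ (k + 1)) y' (fun k => z (k + 1)) := by
      refine ⟨hi1', fun s hs => ?_, fun k hk => ?_⟩
      · rcases eq_or_lt_of_le hs.1 with rfl | hsθ
        · rw [Finset.sum_eq_zero fun j _ => if_neg (hθ.mono (Nat.zero_le (j + 1))).not_gt]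
          simp [hy']
        · rw [hyy s hsθ, h.state s ⟨h0.1.trans hs.1, hs.2⟩, hint' s hs, Finset.sum_range_succ',
            if_pos hsθ, hz0]
          abel
      · rw [h.preJump (k + 1) (by omega), Finset.sum_range_succ', hz0,
          hint' _ ⟨hθ.mono (Nat.zero_le _), hθ.le_T _ (by omega)⟩]
        abel
    obtain ⟨hψi, hpay⟩ := ih ht0 hθ.tail htail
    obtain ⟨hψ, hψint⟩ := integral_glue (u := fun r => D.ψ r (y r) (τ.1 r)) h0.1 h0.2
      (intervalIntegrable_ψ_flow hD hc τ ht x ht.1 h0.1 h0.2) hψi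
      (fun r hr => by simp only [hy r (Ioc_subset_Icc_self hr)])
      (fun r hr => by simp only [hyy r hr.1])
    refine ⟨hψ, ?_⟩
    rw [pay, ← hpay, hψint D.T (right_mem_Icc.2 h0.2), hint' D.T (right_mem_Icc.2 h0.2),
      Finset.sum_range_succ', Finset.sum_range_succ', hz0, run, ← hp,
      add_right_comm p (D.g _ _ _), add_assoc (p + _) (D.g _ _ _),
      add_comm (D.g (θ 0) p (ξ 0))]
    ring

/-! ### The value as an inf-sup of pay-offs determined by the controls -/

/-- The number of jumps that take place. -/
def ImpulseControl.num {t : ℝ} (d : D.ImpulseControl t) : ℕ := d.jumps.card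

/-- Jump instants are nondecreasing, so the indices of jumps up to `T` form an initial segment. -/
theorem ImpulseControl.jumps_eq {t : ℝ} (d : D.ImpulseControl t) :
    d.jumps = Finset.range d.num := by
  have hmem : ∀ k, k ∈ d.jumps ↔ d.time k ≤ D.T := fun k => by simp [jumps]
  have hlow : ∀ k ∈ d.jumps, Finset.range (k + 1) ⊆ d.jumps := fun k hk j hj => by
    rw [hmem] at hk ⊢
    exact (d.monotone_time (Nat.lt_succ_iff.1 (Finset.mem_range.1 hj))).trans hk
  refine Finset.eq_of_subset_of_card_le (fun k hk => ?_) (by simp [num])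
  have := Finset.card_le_card (hlow k hk)
  rw [Finset.card_range] at this
  exact Finset.mem_range.2 this

theorem ImpulseControl.lt_num_iff {t : ℝ} (d : D.ImpulseControl t) {k : ℕ} :
    k < d.num ↔ d.time k ≤ D.T := by
  rw [← Finset.mem_range, ← d.jumps_eq]
  simp [jumps]

theorem ImpulseControl.num_eq {t : ℝ} (d : D.ImpulseControl t) {n : ℕ}
    (h : ∀ k, k < n ↔ d.time k ≤ D.T) : d.num = n :=
  Nat.le_antisymm (not_lt.1 fun hn => lt_irrefl _ ((h n).2 (d.lt_num_iff.1 hn)))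
    (not_lt.1 fun hn => lt_irrefl _ (d.lt_num_iff.2 ((h d.num).1 hn)))

theorem ImpulseControl.admissible {t : ℝ} (d : D.ImpulseControl t) :
    D.Admissible d.num t d.time :=
  ⟨d.le_time, d.monotone_time, fun _ hk => d.lt_num_iff.1 hk⟩

/-- The pay-off of the trajectory determined by the controls. -/
def outcome (D : ImpulseGame m) (x : StateSpace m) (τ : D.Control) {t : ℝ}
    (d : D.ImpulseControl t) : ℝ := D.pay τ d.num t x d.time d.impulse

theorem isTrajectory_iff {t : ℝ} {x : StateSpace m} {τ : D.Control} {d : D.ImpulseControl t}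
    {y : ℝ → StateSpace m} {z : ℕ → StateSpace m} :
    D.IsTrajectory t x τ d y z ↔ D.IsJumpTrajectory d.num t x τ d.time d.impulse y z := by
  have hs : ∀ s, (∑ j ∈ Finset.range d.num,
      if d.time j < s then D.g (d.time j) (z j) (d.impulse j) else 0) =
      ∑ j ∈ d.jumps with d.time j < s, D.g (d.time j) (z j) (d.impulse j) := fun s => by
    rw [Finset.sum_filter, d.jumps_eq]
  constructor
  · intro h
    refine ⟨h.integrable, fun s hs' => ?_, fun k hk => h.preJump k ?_⟩
    · rw [hs, h.state s hs']
    · rw [d.jumps_eq]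
      exact Finset.mem_range.2 hk
  · intro h
    refine ⟨h.integrable, fun s hs' => ?_, fun k hk => h.preJump k ?_⟩
    · rw [h.state s hs', hs]
    · rw [d.jumps_eq] at hk
      exact Finset.mem_range.1 hk

theorem IsTrajectory.payoff_eq (hD : D.Standing) (hc : D.Bounds c) {t : ℝ} (ht : t ∈ Icc 0 D.T)
    {x : StateSpace m} {τ : D.Control} {d : D.ImpulseControl t}
    {y : ℝ → StateSpace m} {z : ℕ → StateSpace m} (h : D.IsTrajectory t x τ d y z) :
    D.payoff t x τ d y z = D.outcome x τ d := by
  rw [outcome, ← ((isTrajectory_iff.1 h).payoff_eq hD hc τ ht d.admissible).2, payoff, finalState,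
    d.jumps_eq]

/-- Uniqueness makes the pay-off the same for all trajectories of given controls; existence prevents
the inner supremum from being `⊥`. -/
theorem value_eq (hD : D.Standing) (hc : D.Bounds c) {t : ℝ} (ht : t ∈ Icc 0 D.T)
    (x : StateSpace m) :
    D.value t x = ⨅ φ : D.Strategy t, ⨆ τ : D.Control, (D.outcome x τ (φ.1 τ) : EReal) := by
  refine iInf_congr fun φ => iSup_congr fun τ => le_antisymm ?_ ?_
  · refine iSup_le fun y => iSup_le fun z => iSup_le fun h => ?_
    rw [h.payoff_eq hD hc ht]
  · obtain ⟨y, z, h⟩ := exists_isJumpTrajectory hD hc τ x (φ.1 τ).impulse ht (φ.1 τ).admissible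
    have h' := isTrajectory_iff.2 h
    refine le_trans ?_ ((le_iSup _ y).trans' ((le_iSup _ z).trans' (le_iSup _ h')))
    rw [h'.payoff_eq hD hc ht]

/-- The term `n * α` is what later bounds the number of jumps, both in near-optimal play and at the
terminal time. -/
theorem le_pay (hD : D.Standing) (hc : D.Bounds c) (τ : D.Control) {α : ℝ}
    (hα : ∀ t ∈ Icc 0 D.T, ∀ x ξ, α ≤ D.C t x ξ) {n : ℕ} :
    ∀ {t : ℝ} (x : StateSpace m) {θ : ℕ → ℝ} (ξ : ℕ → StateSpace m), t ∈ Icc 0 D.T →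
      D.Admissible n t θ → -c * (D.T - t) + n * α - c ≤ D.pay τ n t x θ ξ := by
  induction n with
  | zero =>
    intro t x θ ξ ht _
    have h1 := le_run hD hc τ ht x (right_mem_Icc.2 ht.2)
    have h2 := hc.G_lower (D.flow τ t x D.T)
    rw [pay]
    push_cast
    linarith
  | succ n ih =>
    intro t x θ ξ ht hθ
    have h0 := hθ.head_mem
    have h0' : θ 0 ∈ Icc 0 D.T := ⟨ht.1.trans h0.1, h0.2⟩
    have h1 := le_run hD hc τ ht x h0
    have h2 := hα _ h0' (D.flow τ t x (θ 0)) (ξ 0)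
    have h3 := ih (D.flow τ t x (θ 0) + D.g (θ 0) (D.flow τ t x (θ 0)) (ξ 0))
      (fun k => ξ (k + 1)) h0' hθ.tail
    rw [pay]
    push_cast
    linarith

theorem pay_zero_le (hD : D.Standing) (hc : D.Bounds c) (τ : D.Control) {t : ℝ}
    (ht : t ∈ Icc 0 D.T) (x : StateSpace m) (θ : ℕ → ℝ) (ξ : ℕ → StateSpace m) :
    D.pay τ 0 t x θ ξ ≤ c * ((1 + ‖x‖) * Real.exp (c * D.T)) * (D.T + 1) := by
  have hT := right_mem_Icc.2 ht.2
  have h1 := (abs_le.1 (abs_run_le hD hc τ ht x hT)).2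
  have h2 := (abs_le.1 (hc.G_growth (D.flow τ t x D.T))).2
  have h3 := mul_le_mul_of_nonneg_left (one_add_norm_flow_le hD hc τ ht x hT) hc.nonneg
  have h4 : 0 ≤ c * ((1 + ‖x‖) * Real.exp (c * D.T)) :=
    mul_nonneg hc.nonneg (by positivity)
  have h5 := mul_nonneg h4 ht.1
  rw [pay]
  linarith

theorem pay_congr (hD : D.Standing) (hc : D.Bounds c) {τ τ' : D.Control} {n : ℕ} :
    ∀ {t : ℝ} (x : StateSpace m) {θ : ℕ → ℝ} (ξ : ℕ → StateSpace m), t ∈ Icc 0 D.T →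
      D.Admissible n t θ → (∀ r, t ≤ r → τ'.1 r = τ.1 r) →
      D.pay τ' n t x θ ξ = D.pay τ n t x θ ξ := by
  induction n with
  | zero =>
    intro t x θ ξ ht _ h
    rw [pay, pay, run_congr hD hc ht.1 ht.2 le_rfl x fun r hr => h r hr.1,
      flow_congr hD hc ht.1 ht.2 le_rfl x (fun r hr => h r hr.1) _ (right_mem_Icc.2 ht.2)]
  | succ n ih =>
    intro t x θ ξ ht hθ h
    have h0 := hθ.head_mem
    rw [pay, pay, run_congr hD hc ht.1 h0.1 h0.2 x fun r hr => h r hr.1,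
      flow_congr hD hc ht.1 h0.1 h0.2 x (fun r hr => h r hr.1) _ (right_mem_Icc.2 h0.1),
      ih _ _ ⟨ht.1.trans h0.1, h0.2⟩ hθ.tail fun r hr => h r (h0.1.trans hr)]

theorem pay_eq_run_add (hD : D.Standing) (hc : D.Bounds c) (τ : D.Control) {n : ℕ} {t s : ℝ}
    (x : StateSpace m) {θ : ℕ → ℝ} (ξ : ℕ → StateSpace m) (ht : 0 ≤ t) (hts : t ≤ s)
    (hs : s ≤ D.T) (hθ : D.Admissible n s θ) :
    D.pay τ n t x θ ξ = D.run τ t x s + D.pay τ n s (D.flow τ t x s) θ ξ := by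
  cases n with
  | zero =>
    rw [pay, pay, ← add_assoc, run_add_run hD hc τ ht hts hs le_rfl,
      flow_flow hD hc τ ht hts hs x _ (right_mem_Icc.2 hs)]
  | succ n =>
    have h0 := hθ.head_mem
    rw [pay, pay, ← add_assoc, ← add_assoc, run_add_run hD hc τ ht hts h0.1 h0.2,
      flow_flow hD hc τ ht hts hs x _ h0]

/-! ### Finiteness of the value and bounds on the number of jumps -/

/-- The value function as a real number. -/
def val (D : ImpulseGame m) (t : ℝ) (x : StateSpace m) : ℝ := (D.value t x).toReal

/-- An impulse control is an infinite sequence of nonzero vectors, even if no jump takes place, so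
none exists in dimension zero. -/
instance [NeZero m] : Nontrivial (StateSpace m) :=
  have : Nonempty (Fin m) := ⟨0⟩
  inferInstance

/-- The impulse control without jumps. -/
def ImpulseControl.never [NeZero m] (D : ImpulseGame m) {t : ℝ} (ht : t ≤ D.T) :
    D.ImpulseControl t where
  time _ := D.T + 1
  impulse _ := (exists_ne (0 : StateSpace m)).choose
  le_time _ := by linarith
  monotone_time := monotone_const
  impulse_ne_zero _ := (exists_ne (0 : StateSpace m)).choose_spec
  finite_jumps := by
    convert Set.finite_empty
    ext k
    simp

theorem ImpulseControl.num_never [NeZero m] {t : ℝ} (ht : t ≤ D.T) :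
    (ImpulseControl.never D ht).num = 0 :=
  num_eq _ fun k => by simp [never]

theorem Control.nonempty (hD : D.Standing) : Nonempty D.Control := by
  obtain ⟨e, he⟩ := hD.K_nonempty
  exact ⟨⟨fun _ => e, measurable_const, fun _ => he⟩⟩

theorem le_outcome (hD : D.Standing) (hc : D.Bounds c) {t : ℝ} (ht : t ∈ Icc 0 D.T)
    (x : StateSpace m) (τ : D.Control) (d : D.ImpulseControl t) :
    -c * D.T - c ≤ D.outcome x τ d := by
  obtain ⟨α, hα0, hα⟩ := hD.C_lower
  have h := le_pay hD hc τ hα x d.impulse ht d.admissible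
  have h1 : 0 ≤ (d.num : ℝ) * α := by positivity
  have h2 := mul_nonneg hc.nonneg ht.1
  rw [outcome]
  linarith

/-- The strategy without jumps. -/
def Strategy.never [NeZero m] (D : ImpulseGame m) {t : ℝ} (ht : t ≤ D.T) : D.Strategy t :=
  ⟨fun _ => ImpulseControl.never D ht, fun _ _ _ _ _ _ _ => ⟨rfl, rfl⟩⟩

theorem value_eq_val [NeZero m] (hD : D.Standing) (hc : D.Bounds c) {t : ℝ} (ht : t ∈ Icc 0 D.T)
    (x : StateSpace m) : D.value t x = (D.val t x : EReal) := by
  have hne := Control.nonempty hD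
  rw [val, EReal.coe_toReal]
  · rw [value_eq hD hc ht]
    refine ne_top_of_le_ne_top (EReal.coe_ne_top
      (c * ((1 + ‖x‖) * Real.exp (c * D.T)) * (D.T + 1)))
      (iInf_le_of_le (Strategy.never D ht.2) (iSup_le fun τ => ?_))
    rw [EReal.coe_le_coe_iff, Strategy.never, outcome, ImpulseControl.num_never]
    exact pay_zero_le hD hc τ ht x _ _
  · rw [value_eq hD hc ht]
    refine ne_bot_of_le_ne_bot (EReal.coe_ne_bot (-c * D.T - c))
      (le_iInf fun φ => le_iSup_of_le hne.some ?_)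
    exact EReal.coe_le_coe_iff.2 (le_outcome hD hc ht x _ _)

theorem val_le [NeZero m] (hD : D.Standing) (hc : D.Bounds c) {t : ℝ} (ht : t ∈ Icc 0 D.T)
    {x : StateSpace m} (φ : D.Strategy t) {M : ℝ} (h : ∀ τ, D.outcome x τ (φ.1 τ) ≤ M) :
    D.val t x ≤ M := by
  rw [← EReal.coe_le_coe_iff, ← value_eq_val hD hc ht, value_eq hD hc ht]
  exact iInf_le_of_le φ (iSup_le fun τ => EReal.coe_le_coe_iff.2 (h τ))

theorem exists_strategy [NeZero m] (hD : D.Standing) (hc : D.Bounds c) {t : ℝ}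
    (ht : t ∈ Icc 0 D.T) (x : StateSpace m) {ε : ℝ} (hε : 0 < ε) :
    ∃ φ : D.Strategy t, ∀ τ, D.outcome x τ (φ.1 τ) ≤ D.val t x + ε := by
  have h : D.value t x < ((D.val t x + ε : ℝ) : EReal) := by
    rw [value_eq_val hD hc ht, EReal.coe_lt_coe_iff]
    linarith
  rw [value_eq hD hc ht, iInf_lt_iff] at h
  obtain ⟨φ, hφ⟩ := h
  exact ⟨φ, fun τ => EReal.coe_le_coe_iff.1 ((le_iSup _ τ).trans hφ.le)⟩

theorem val_le_growth [NeZero m] (hD : D.Standing) (hc : D.Bounds c) {t : ℝ} (ht : t ∈ Icc 0 D.T)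
    (x : StateSpace m) :
    D.val t x ≤ c * ((1 + ‖x‖) * Real.exp (c * D.T)) * (D.T + 1) :=
  val_le hD hc ht (Strategy.never D ht.2) fun τ => by
    rw [Strategy.never, outcome, ImpulseControl.num_never]
    exact pay_zero_le hD hc τ ht x _ _

/-- Each jump costs at least `α`, while the value is at most the cost of never jumping, which is
bounded for `‖x‖ ≤ R`. -/
theorem exists_num_le [NeZero m] (hD : D.Standing) (hc : D.Bounds c) (R : ℝ) :
    ∃ N : ℕ, ∀ t ∈ Icc 0 D.T, ∀ x : StateSpace m, ‖x‖ ≤ R → ∀ (τ : D.Control)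
      (d : D.ImpulseControl t), D.outcome x τ d ≤ D.val t x + 1 → d.num ≤ N := by
  obtain ⟨α, hα0, hα⟩ := hD.C_lower
  set B := c * ((1 + R) * Real.exp (c * D.T)) * (D.T + 1) with hB
  refine ⟨⌈(B + 1 + c * D.T + c) / α⌉₊, fun t ht x hx τ d hd => ?_⟩
  have h := le_pay hD hc τ hα x d.impulse ht d.admissible
  have h2 := mul_nonneg hc.nonneg ht.1
  have h3 := val_le_growth hD hc ht x
  have h4 : c * ((1 + ‖x‖) * Real.exp (c * D.T)) * (D.T + 1) ≤ B := by
    have := hc.nonneg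
    have := hD.T_pos
    rw [hB]
    gcongr
  rw [outcome] at hd
  have h5 : (d.num : ℝ) ≤ (B + 1 + c * D.T + c) / α := by
    rw [le_div_iff₀ hα0]
    linarith
  exact_mod_cast h5.trans (Nat.le_ceil _)

/-! ### Moduli of continuity and dependence of the pay-off on initial data -/

theorem exists_modulus_of_continuousOn (hK : IsCompact D.K) {E : Type*} [NormedAddCommGroup E]
    {H : ℝ × StateSpace m × StateSpace m → E}
    (hH : ContinuousOn H (Icc 0 D.T ×ˢ (univ ×ˢ D.K))) (R : ℝ) {ε : ℝ} (hε : 0 < ε) :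
    ∃ δ > 0, ∀ s ∈ Icc 0 D.T, ∀ s' ∈ Icc 0 D.T, ∀ y y' : StateSpace m, ‖y‖ ≤ R → ‖y'‖ ≤ R →
      |s - s'| ≤ δ → ‖y - y'‖ ≤ δ → ∀ τ ∈ D.K, ‖H (s, y, τ) - H (s', y', τ)‖ ≤ ε := by
  have hcomp : IsCompact (Icc 0 D.T ×ˢ (Metric.closedBall (0 : StateSpace m) R ×ˢ D.K)) :=
    isCompact_Icc.prod ((isCompact_closedBall _ _).prod hK)
  have hu := hcomp.uniformContinuousOn_of_continuous
    (hH.mono (prod_mono le_rfl (prod_mono (subset_univ _) le_rfl)))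
  obtain ⟨δ, hδ, h⟩ := Metric.uniformContinuousOn_iff.1 hu ε hε
  refine ⟨δ / 2, half_pos hδ, fun s hs s' hs' y y' hy hy' hss hyy τ hτ => ?_⟩
  rw [← dist_eq_norm]
  refine (h (s, y, τ) ⟨hs, mem_closedBall_zero_iff.2 hy, hτ⟩ (s', y', τ)
    ⟨hs', mem_closedBall_zero_iff.2 hy', hτ⟩ ?_).le
  rw [Prod.dist_eq, Prod.dist_eq, dist_self, Real.dist_eq, dist_eq_norm]
  exact max_lt (by linarith) (max_lt (by linarith) hδ)

/-- Impulses range over a noncompact set, so uniformity in the index comes from equicontinuity, made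
uniform by compactness in time and state only. -/
theorem exists_modulus_of_equicontinuousOn {T : ℝ} {ι E : Type*} [NormedAddCommGroup E]
    {F : ι → ℝ × StateSpace m → E} (hF : EquicontinuousOn F (Icc 0 T ×ˢ univ)) (R : ℝ)
    {ε : ℝ} (hε : 0 < ε) :
    ∃ δ > 0, ∀ s ∈ Icc 0 T, ∀ s' ∈ Icc 0 T, ∀ y y' : StateSpace m, ‖y‖ ≤ R → ‖y'‖ ≤ R →
      |s - s'| ≤ δ → ‖y - y'‖ ≤ δ → ∀ i, ‖F i (s, y) - F i (s', y')‖ ≤ ε := by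
  have : CompactSpace ↥(Icc 0 T ×ˢ Metric.closedBall (0 : StateSpace m) R) :=
    isCompact_iff_compactSpace.1 (isCompact_Icc.prod (isCompact_closedBall _ _))
  have hu := CompactSpace.uniformEquicontinuous_of_equicontinuous
    ((equicontinuous_restrict_iff F).2
      (hF.mono (prod_mono (le_refl (Icc 0 T)) (subset_univ (Metric.closedBall 0 R)))))
  obtain ⟨δ, hδ, h⟩ := Metric.uniformEquicontinuous_iff.1 hu ε hε
  refine ⟨δ / 2, half_pos hδ, fun s hs s' hs' y y' hy hy' hss hyy i => ?_⟩
  rw [← dist_eq_norm]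
  refine (h ⟨(s, y), hs, mem_closedBall_zero_iff.2 hy⟩
    ⟨(s', y'), hs', mem_closedBall_zero_iff.2 hy'⟩ ?_ i).le
  rw [Subtype.dist_eq, Prod.dist_eq, Real.dist_eq, dist_eq_norm]
  exact max_lt (by linarith) (by linarith)

theorem equicontinuousOn_jump (hD : D.Standing) (hc : D.Bounds c) :
    EquicontinuousOn (fun (ξ : StateSpace m) (p : ℝ × StateSpace m) => D.g p.1 p.2 ξ)
      (Icc 0 D.T ×ˢ univ) := by
  rintro ⟨s, y⟩ ⟨hs, -⟩
  rw [Metric.uniformity_basis_dist.equicontinuousWithinAt_iff_right]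
  intro ε hε
  have h1 : ∀ᶠ s' in 𝓝[Icc 0 D.T] s, ∀ ξ, dist (D.g s y ξ) (D.g s' y ξ) < ε / 2 :=
    (Metric.uniformity_basis_dist.equicontinuousWithinAt_iff_right.1 (hD.g_equicont y s hs))
      (ε / 2) (half_pos hε)
  have h2 : ∀ᶠ y' in 𝓝 y, c * ‖y - y'‖ < ε / 2 := by
    have : Tendsto (fun y' => c * ‖y - y'‖) (𝓝 y) (𝓝 (c * ‖y - y‖)) := by
      apply Continuous.tendsto
      fun_prop
    exact this.eventually_lt_const (by simpa using half_pos hε)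
  rw [nhdsWithin_prod_eq, nhdsWithin_univ]
  filter_upwards [h1.prod_mk h2, prod_mem_prod (s := Icc 0 D.T) (t := univ)
    self_mem_nhdsWithin univ_mem] with ⟨s', y'⟩ ⟨h3, h4⟩ ⟨hs', _⟩ ξ
  have h5 := hc.g_lip s' hs' ξ y y'
  rw [← dist_eq_norm] at h5
  simp only
  have := dist_triangle (D.g s y ξ) (D.g s' y ξ) (D.g s' y' ξ)
  have := h3 ξ
  simp only at h4
  linarith

/-- The instant `max θ t'` is `θ` postponed to the later initial time; if `θ ≤ t'` the second
trajectory has not moved yet. -/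
theorem flow_run_near (hD : D.Standing) (hc : D.Bounds c) (R : ℝ) {ε : ℝ} (hε : 0 < ε) :
    ∃ δ > 0, ∀ t ∈ Icc 0 D.T, ∀ t' ∈ Icc 0 D.T, t ≤ t' → t' - t ≤ δ →
      ∀ x x' : StateSpace m, ‖x‖ ≤ R → ‖x'‖ ≤ R → ‖x - x'‖ ≤ δ → ∀ τ : D.Control,
      ∀ θ ∈ Icc t D.T, ‖D.flow τ t x θ - D.flow τ t' x' (max θ t')‖ ≤ ε ∧
        |D.run τ t x θ - D.run τ t' x' (max θ t')| ≤ ε := by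
  rcases lt_or_ge R 0 with hR | hR
  · exact ⟨1, one_pos, fun _ _ _ _ _ _ x _ hx => absurd ((norm_nonneg x).trans hx) hR.not_ge⟩
  have hT := hD.T_pos
  have hc0 := hc.nonneg
  set A := Real.exp (c * D.T) with hA
  have hA1 : 1 ≤ A := Real.one_le_exp (by positivity)
  set M := c * ((1 + R) * A) with hM
  have hM0 : 0 ≤ M := by positivity
  obtain ⟨δ₁, hδ₁, h₁⟩ := exists_modulus_of_continuousOn hD.K_compact hD.ψ_cont
    ((1 + R) * A) (show 0 < ε / (2 * (D.T + 1)) by positivity)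
  -- `M` bounds speed and running cost on `[t, t']`, so the states differ there by at most `(M + 1)
  -- * δ`; the flow then amplifies this by at most `A`.
  set δ := min ε δ₁ / (2 * (M + 1) * A) with hδ
  have hm : 0 < min ε δ₁ := lt_min hε hδ₁
  have hδ0 : 0 < δ := by positivity
  have hδA : 2 * ((M + 1) * δ * A) = min ε δ₁ := by
    rw [hδ]
    field_simp
  have hδ' : (M + 1) * δ ≤ (M + 1) * δ * A := le_mul_of_one_le_right (by positivity) hA1
  have hpos : 0 ≤ (M + 1) * δ * A := by positivity
  have hle1 := min_le_left ε δ₁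
  have hle2 := min_le_right ε δ₁
  have hMδ : (M + 1) * δ = M * δ + δ := by ring
  refine ⟨δ, hδ0, fun t ht t' ht' htt hδt x x' hx hx' hxx τ θ hθ => ?_⟩
  have hbd : ∀ {s : ℝ}, s ∈ Icc 0 D.T → ∀ {z : StateSpace m}, ‖z‖ ≤ R → ∀ r ∈ Icc s D.T,
      1 + ‖D.flow τ s z r‖ ≤ (1 + R) * A := fun hs z hz r hr =>
    (one_add_norm_flow_le hD hc τ hs z hr).trans (by gcongr)
  have hMx : c * ((1 + ‖x‖) * A) ≤ M := by rw [hM]; gcongr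
  have hfl : ∀ r ∈ Icc t t', ‖D.flow τ t x r - x‖ ≤ M * δ := fun r hr =>
    (norm_flow_sub_le hD hc τ ht x ⟨hr.1, hr.2.trans ht'.2⟩).trans
      (mul_le_mul hMx (by linarith [hr.2]) (by linarith [hr.1]) hM0)
  have hrn : ∀ r ∈ Icc t t', |D.run τ t x r| ≤ M * δ := fun r hr =>
    (abs_run_le hD hc τ ht x ⟨hr.1, hr.2.trans ht'.2⟩).trans
      (mul_le_mul hMx (by linarith [hr.2]) (by linarith [hr.1]) hM0)
  rcases le_or_gt θ t' with hθt | hθt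
  · rw [max_eq_right hθt, flow_self hD hc τ ht', run_self, sub_zero]
    refine ⟨?_, ?_⟩
    · have := norm_sub_le_norm_sub_add_norm_sub (D.flow τ t x θ) x x'
      linarith [hfl θ ⟨hθ.1, hθt⟩]
    · linarith [hrn θ ⟨hθ.1, hθt⟩]
  · rw [max_eq_left hθt.le]
    have hp : ‖D.flow τ t x t' - x'‖ ≤ (M + 1) * δ := by
      have := norm_sub_le_norm_sub_add_norm_sub (D.flow τ t x t') x x'
      linarith [hfl t' ⟨htt, le_rfl⟩]
    have hdiff : ∀ r ∈ Icc t' D.T,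
        ‖D.flow τ t' (D.flow τ t x t') r - D.flow τ t' x' r‖ ≤ (M + 1) * δ * A := fun r hr =>
      (norm_flow_sub_flow_le hD hc τ ht' _ _ hr).trans
        (mul_le_mul_of_nonneg_right hp (by positivity))
    refine ⟨?_, ?_⟩
    · rw [flow_flow hD hc τ ht.1 htt ht'.2 x θ ⟨hθt.le, hθ.2⟩]
      linarith [hdiff θ ⟨hθt.le, hθ.2⟩]
    · have hψ : |D.run τ t' (D.flow τ t x t') θ - D.run τ t' x' θ| ≤ ε / 2 := by
        rw [run, run, ← intervalIntegral.integral_sub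
          (intervalIntegrable_ψ_flow hD hc τ ht' _ ht'.1 hθt.le hθ.2)
          (intervalIntegrable_ψ_flow hD hc τ ht' _ ht'.1 hθt.le hθ.2), ← Real.norm_eq_abs]
        refine (intervalIntegral.norm_integral_le_of_norm_le_const
          (C := ε / (2 * (D.T + 1))) fun r hr => ?_).trans ?_
        · rw [uIoc_of_le hθt.le] at hr
          have hr1 : r ∈ Icc t' D.T := ⟨hr.1.le, hr.2.trans hθ.2⟩
          have hr0 : r ∈ Icc 0 D.T := ⟨ht'.1.trans hr1.1, hr1.2⟩
          have e1 := hbd ht hx r ⟨htt.trans hr1.1, hr1.2⟩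
          rw [flow_flow hD hc τ ht.1 htt ht'.2 x r hr1] at e1
          have e2 := hbd ht' hx' r hr1
          have e3 := hdiff r hr1
          exact h₁ r hr0 r hr0 (D.flow τ t' (D.flow τ t x t') r) (D.flow τ t' x' r) (by linarith) (by linarith) (by simpa using hδ₁.le)
            (by linarith) _ (τ.2.2 r)
        · rw [abs_of_nonneg (by linarith), div_mul_eq_mul_div, div_le_iff₀ (by positivity)]
          have : ε * (θ - t') ≤ ε * (D.T + 1) :=
            mul_le_mul_of_nonneg_left (by linarith [hθ.2, ht'.1]) hε.le
          linarith
      rw [← run_add_run hD hc τ ht.1 htt hθt.le hθ.2, add_sub_assoc]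
      refine (abs_add_le _ _).trans ?_
      linarith [hrn t' ⟨htt, le_rfl⟩]

/-- Induction on the number of jumps, comparing the two states just after the first jump. The
modulus depends on `n`, since the radius and the errors grow at each jump, but not on the control,
instants or impulses. -/
theorem pay_near (hD : D.Standing) (hc : D.Bounds c) (n : ℕ) : ∀ (R : ℝ) {ε : ℝ}, 0 < ε →
    ∃ δ > 0, ∀ t ∈ Icc 0 D.T, ∀ t' ∈ Icc 0 D.T, t ≤ t' → t' - t ≤ δ →
      ∀ x x' : StateSpace m, ‖x‖ ≤ R → ‖x'‖ ≤ R → ‖x - x'‖ ≤ δ → ∀ (τ : D.Control) (θ : ℕ → ℝ)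
      (ξ : ℕ → StateSpace m), D.Admissible n t θ →
        |D.pay τ n t x θ ξ - D.pay τ n t' x' (fun k => max (θ k) t') ξ| ≤ ε := by
  induction n with
  | zero =>
    intro R ε hε
    obtain ⟨δ₁, hδ₁, h₁⟩ := Metric.uniformContinuous_iff.1 hD.G_unifCont (ε / 2) (half_pos hε)
    obtain ⟨δ, hδ, h⟩ := flow_run_near hD hc R (lt_min (half_pos hε) (half_pos hδ₁))
    refine ⟨δ, hδ, fun t ht t' ht' htt hδt x x' hx hx' hxx τ θ ξ _ => ?_⟩
    obtain ⟨e1, e2⟩ := h t ht t' ht' htt hδt x x' hx hx' hxx τ D.T (right_mem_Icc.2 ht.2)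
    rw [max_eq_left ht'.2] at e1 e2
    have e3 := (h₁ (a := D.flow τ t x D.T) (b := D.flow τ t' x' D.T) (by
      rw [dist_eq_norm]
      linarith [min_le_right (ε / 2) (δ₁ / 2)])).le
    rw [Real.dist_eq] at e3
    rw [pay, pay, add_sub_add_comm]
    refine (abs_add_le _ _).trans ?_
    linarith [min_le_left (ε / 2) (δ₁ / 2)]
  | succ n ih =>
    intro R ε hε
    rcases lt_or_ge R 0 with hR | hR
    · exact ⟨1, one_pos, fun _ _ _ _ _ _ x _ hx => absurd ((norm_nonneg x).trans hx) hR.not_ge⟩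
    have hc0 := hc.nonneg
    set R₁ := (1 + R) * Real.exp (c * D.T) with hR₁
    obtain ⟨δ₁, hδ₁, h₁⟩ := ih (R₁ + c * (1 + R₁)) (show 0 < ε / 3 by positivity)
    obtain ⟨δ₂, hδ₂, h₂⟩ := exists_modulus_of_equicontinuousOn hD.C_equicont R₁
      (show 0 < ε / 3 by positivity)
    obtain ⟨δ₃, hδ₃, h₃⟩ := exists_modulus_of_equicontinuousOn (equicontinuousOn_jump hD hc) R₁
      (half_pos hδ₁)
    set η := min (min (ε / 3) (δ₁ / 2)) (min δ₂ δ₃) with hη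
    have hη0 : 0 < η := by positivity
    have hη1 : η ≤ ε / 3 := (min_le_left _ _).trans (min_le_left _ _)
    have hη2 : η ≤ δ₁ / 2 := (min_le_left _ _).trans (min_le_right _ _)
    have hη3 : η ≤ δ₂ := (min_le_right _ _).trans (min_le_left _ _)
    have hη4 : η ≤ δ₃ := (min_le_right _ _).trans (min_le_right _ _)
    obtain ⟨δ₄, hδ₄, h₄⟩ := flow_run_near hD hc R hη0
    refine ⟨min δ₄ η, lt_min hδ₄ hη0, fun t ht t' ht' htt hδt x x' hx hx' hxx τ θ ξ hθ => ?_⟩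
    have h0 := hθ.head_mem
    obtain ⟨e1, e2⟩ := h₄ t ht t' ht' htt (hδt.trans (min_le_left _ _)) x x' hx hx'
      (hxx.trans (min_le_left _ _)) τ (θ 0) h0
    have hδη : t' - t ≤ η := hδt.trans (min_le_right _ _)
    set θ' := max (θ 0) t' with hθ'
    have hθθ : θ 0 ≤ θ' := le_max_left _ _
    have hθd : θ' - θ 0 ≤ η := by
      have : θ' ≤ θ 0 + η := max_le (by linarith) (by linarith [h0.1])
      linarith
    have hθa : |θ 0 - θ'| ≤ η := by
      rw [abs_sub_comm, abs_of_nonneg (by linarith)]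
      exact hθd
    have hθ0 : θ 0 ∈ Icc 0 D.T := ⟨ht.1.trans h0.1, h0.2⟩
    have hθ1 : θ' ∈ Icc 0 D.T := ⟨hθ0.1.trans hθθ, max_le h0.2 ht'.2⟩
    set p := D.flow τ t x (θ 0) with hp
    set p' := D.flow τ t' x' θ' with hp'
    have hpR : ‖p‖ ≤ R₁ := by
      have : (1 + ‖x‖) * Real.exp (c * D.T) ≤ R₁ := by rw [hR₁]; gcongr
      linarith [one_add_norm_flow_le hD hc τ ht x h0]
    have hpR' : ‖p'‖ ≤ R₁ := by
      have : (1 + ‖x'‖) * Real.exp (c * D.T) ≤ R₁ := by rw [hR₁]; gcongr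
      linarith [one_add_norm_flow_le hD hc τ ht' x' (s := θ') ⟨le_max_right _ _, hθ1.2⟩]
    have e3 := h₂ _ hθ0 _ hθ1 p p' hpR hpR' (hθa.trans hη3) (e1.trans hη3) (ξ 0)
    have e4 := h₃ _ hθ0 _ hθ1 p p' hpR hpR' (hθa.trans hη4) (e1.trans hη4) (ξ 0)
    have hnorm : ∀ {s : ℝ}, s ∈ Icc 0 D.T → ∀ {q : StateSpace m}, ‖q‖ ≤ R₁ →
        ‖q + D.g s q (ξ 0)‖ ≤ R₁ + c * (1 + R₁) := fun {s} hs {q} hq =>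
      (norm_add_le _ _).trans (add_le_add hq ((hc.g_growth s hs q (ξ 0)).trans (by gcongr)))
    have e5 := h₁ _ hθ0 _ hθ1 hθθ (by linarith) (p + D.g (θ 0) p (ξ 0)) (p' + D.g θ' p' (ξ 0))
      (hnorm hθ0 hpR) (hnorm hθ1 hpR') (by
        rw [add_sub_add_comm]
        refine (norm_add_le _ _).trans ?_
        linarith) τ _ (fun k => ξ (k + 1)) hθ.tail
    -- Later jumps never precede `θ 0`, so postponing them to `θ'` or to `t'` is the same; this
    -- makes the induction hypothesis fit.
    have hmax : (fun k => max (θ (k + 1)) θ') = fun k => max (θ (k + 1)) t' := by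
      funext k
      rw [hθ', ← max_assoc, max_eq_left (hθ.mono (Nat.zero_le (k + 1)))]
    rw [hmax] at e5
    rw [Real.norm_eq_abs] at e3
    rw [pay, pay, add_sub_add_comm, add_sub_add_comm]
    refine (abs_add_le _ _).trans ((add_le_add (abs_add_le _ _) e5).trans ?_)
    linarith

theorem pay_near_of_le (hD : D.Standing) (hc : D.Bounds c) (N : ℕ) (R : ℝ) {ε : ℝ}
    (hε : 0 < ε) : ∃ δ > 0, ∀ n ≤ N, ∀ t ∈ Icc 0 D.T, ∀ t' ∈ Icc 0 D.T, t ≤ t' → t' - t ≤ δ →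
      ∀ x x' : StateSpace m, ‖x‖ ≤ R → ‖x'‖ ≤ R → ‖x - x'‖ ≤ δ → ∀ (τ : D.Control) (θ : ℕ → ℝ)
      (ξ : ℕ → StateSpace m), D.Admissible n t θ →
        |D.pay τ n t x θ ξ - D.pay τ n t' x' (fun k => max (θ k) t') ξ| ≤ ε := by
  choose δ hδ h using fun n => pay_near hD hc n R hε
  have hne : (Finset.range (N + 1)).Nonempty := ⟨0, by simp⟩
  refine ⟨(Finset.range (N + 1)).inf' hne δ, (Finset.lt_inf'_iff _).2 fun n _ => hδ n,
    fun n hn t ht t' ht' htt hδt x x' hx hx' hxx => ?_⟩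
  have hle : (Finset.range (N + 1)).inf' hne δ ≤ δ n :=
    Finset.inf'_le _ (Finset.mem_range.2 (Nat.lt_succ_of_le hn))
  exact h n t ht t' ht' htt (hδt.trans hle) x x' hx hx' (hxx.trans hle)

/-! ### Transport of strategies and continuity of the value -/

/-- An impulse control on `[s, T]`, seen as an impulse control on `[t, T]` for `t ≤ s`. -/
def ImpulseControl.earlier {t s : ℝ} (hts : t ≤ s) (d : D.ImpulseControl s) :
    D.ImpulseControl t :=
  { d with le_time := fun k => hts.trans (d.le_time k) }

/-- The impulse control on `[s, T]` which postpones to `s` all jumps before `s`. -/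
def ImpulseControl.postpone {t : ℝ} (d : D.ImpulseControl t) (s : ℝ) : D.ImpulseControl s where
  time k := max (d.time k) s
  impulse := d.impulse
  le_time _ := le_max_right _ _
  monotone_time _ _ h := max_le_max_right _ (d.monotone_time h)
  impulse_ne_zero := d.impulse_ne_zero
  finite_jumps := d.finite_jumps.subset fun k (hk : max (d.time k) s ≤ D.T) =>
    (le_max_left _ _).trans hk

theorem ImpulseControl.num_postpone {t s : ℝ} (d : D.ImpulseControl t) (hs : s ≤ D.T) :
    (d.postpone s).num = d.num :=
  num_eq _ fun k => by simp [postpone, d.lt_num_iff, hs]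

/-- Do not jump before time `s`, then follow the strategy `Φ τ`, chosen according to the control
before time `s`. -/
def Strategy.delay {t s : ℝ} (hts : t ≤ s) (Φ : D.Control → D.Strategy s)
    (hΦ : ∀ τ₁ τ₂ : D.Control, (∀ r ∈ Ico t s, τ₁.1 r = τ₂.1 r) → Φ τ₁ = Φ τ₂) : D.Strategy t :=
  ⟨fun τ => ((Φ τ).1 τ).earlier hts, fun τ₁ τ₂ q hq h => by
    rcases lt_or_ge q s with hqs | hqs
    · rintro k (hk | hk)
      · exact absurd (((Φ τ₁).1 τ₁).le_time k) (hk.trans_lt hqs).not_ge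
      · exact absurd (((Φ τ₂).1 τ₂).le_time k) (hk.trans_lt hqs).not_ge
    · have e := hΦ τ₁ τ₂ fun r hr => h r ⟨hr.1, hr.2.trans_le hqs⟩
      have := (Φ τ₁).2 τ₁ τ₂ q ⟨hqs, hq.2⟩ fun r hr => h r ⟨hts.trans hr.1, hr.2⟩
      simp only [e] at this ⊢
      exact this⟩

/-- Follow the strategy `φ` as if the control were `τ₀` before time `s`, and postpone to `s` all
jumps before `s`. -/
def Strategy.postpone {t s : ℝ} (hts : t ≤ s) (φ : D.Strategy t) (τ₀ : D.Control) :
    D.Strategy s :=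
  ⟨fun τ => (φ.1 (τ₀.splice s τ)).postpone s, fun τ₁ τ₂ q hq h k hk => by
    have h1 := φ.2 (τ₀.splice s τ₁) (τ₀.splice s τ₂) q ⟨hts.trans hq.1, hq.2⟩ (fun r hr => by
      rcases lt_or_ge r s with hrs | hrs
      · rw [Control.splice_of_lt _ _ hrs, Control.splice_of_lt _ _ hrs]
      · rw [Control.splice_of_le _ _ hrs, Control.splice_of_le _ _ hrs]
        exact h r ⟨hrs, hr.2⟩) k
      (hk.imp (fun e => (le_max_left _ _).trans e) fun e => (le_max_left _ _).trans e)
    exact ⟨congrArg (fun a => max a s) h1.1, h1.2⟩⟩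

/-- A near-optimal strategy at `(t', x')` is used from `t` by waiting until `t'`; one at `(t, x)` is
used from `t'` by postponing its early jumps and feigning an arbitrary past control. -/
theorem val_near [NeZero m] (hD : D.Standing) (hc : D.Bounds c) (R : ℝ) {ε : ℝ} (hε : 0 < ε) :
    ∃ δ > 0, ∀ t ∈ Icc 0 D.T, ∀ t' ∈ Icc 0 D.T, t ≤ t' → t' - t ≤ δ →
      ∀ x x' : StateSpace m, ‖x‖ ≤ R → ‖x'‖ ≤ R → ‖x - x'‖ ≤ δ →
        |D.val t x - D.val t' x'| ≤ ε := by
  obtain ⟨N, hN⟩ := exists_num_le hD hc R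
  obtain ⟨δ, hδ, h⟩ := pay_near_of_le hD hc N R (half_pos hε)
  obtain ⟨τ₀⟩ := Control.nonempty hD
  refine ⟨δ, hδ, fun t ht t' ht' htt hδt x x' hx hx' hxx => ?_⟩
  -- The cap at 1 is the tolerance under which `exists_num_le` bounds the number of jumps.
  have hη : 0 < min (ε / 2) 1 := lt_min (half_pos hε) one_pos
  have hη1 := min_le_left (ε / 2) 1
  have hη2 := min_le_right (ε / 2) 1
  rw [abs_sub_le_iff]
  constructor
  · obtain ⟨φ, hφ⟩ := exists_strategy hD hc ht' x' hη
    have hle : D.val t x ≤ D.val t' x' + ε := by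
      refine val_le hD hc ht (Strategy.delay htt (fun _ => φ) fun _ _ _ => rfl) fun τ => ?_
      have h1 := hN t' ht' x' hx' τ (φ.1 τ) ((hφ τ).trans (by linarith))
      have h2 := h _ h1 t ht t' ht' htt hδt x x' hx hx' hxx τ (φ.1 τ).time (φ.1 τ).impulse
        ((φ.1 τ).admissible.mono_left htt)
      have h3 : (fun k => max ((φ.1 τ).time k) t') = (φ.1 τ).time :=
        funext fun k => max_eq_left ((φ.1 τ).le_time k)
      rw [h3] at h2
      have h4 := hφ τ
      rw [outcome] at h4
      have := (abs_le.1 h2).2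
      change D.pay τ (φ.1 τ).num t x (φ.1 τ).time (φ.1 τ).impulse ≤ _
      linarith
    linarith
  · obtain ⟨φ, hφ⟩ := exists_strategy hD hc ht x hη
    have hle : D.val t' x' ≤ D.val t x + ε := by
      refine val_le hD hc ht' (Strategy.postpone htt φ τ₀) fun τ => ?_
      set τ₁ := τ₀.splice t' τ with hτ₁
      have h1 := hN t ht x hx τ₁ (φ.1 τ₁) ((hφ τ₁).trans (by linarith))
      have h2 := h _ h1 t ht t' ht' htt hδt x x' hx hx' hxx τ₁ (φ.1 τ₁).time (φ.1 τ₁).impulse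
        (φ.1 τ₁).admissible
      have h4 := hφ τ₁
      have h5 := pay_congr hD hc (τ := τ) (τ' := τ₁) x' ((φ.1 τ₁).postpone t').impulse ht'
        ((φ.1 τ₁).postpone t').admissible fun r hr => Control.splice_of_le _ _ hr
      rw [outcome] at h4
      change D.pay τ ((φ.1 τ₁).postpone t').num t' x' ((φ.1 τ₁).postpone t').time
        ((φ.1 τ₁).postpone t').impulse ≤ _
      rw [← h5, ImpulseControl.num_postpone _ ht'.2]
      have := (abs_le.1 h2).1
      change D.pay τ₁ (φ.1 τ₁).num t' x' (fun k => max ((φ.1 τ₁).time k) t')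
        (φ.1 τ₁).impulse ≤ _
      linarith
    linarith

theorem val_near_symm [NeZero m] (hD : D.Standing) (hc : D.Bounds c) (R : ℝ) {ε : ℝ}
    (hε : 0 < ε) : ∃ δ > 0, ∀ t ∈ Icc 0 D.T, ∀ t' ∈ Icc 0 D.T, |t - t'| ≤ δ →
      ∀ x x' : StateSpace m, ‖x‖ ≤ R → ‖x'‖ ≤ R → ‖x - x'‖ ≤ δ →
        |D.val t x - D.val t' x'| ≤ ε := by
  obtain ⟨δ, hδ, h⟩ := val_near hD hc R hε
  refine ⟨δ, hδ, fun t ht t' ht' htt x x' hx hx' hxx => ?_⟩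
  rcases le_total t t' with hle | hle
  · exact h t ht t' ht' hle (by linarith [neg_abs_le (t - t')]) x x' hx hx' hxx
  · rw [abs_sub_comm]
    rw [norm_sub_rev] at hxx
    exact h t' ht' t ht hle (by linarith [le_abs_self (t - t')]) x' x hx' hx hxx

theorem continuousOn_val [NeZero m] (hD : D.Standing) (hc : D.Bounds c) :
    ContinuousOn (fun p : ℝ × StateSpace m => D.val p.1 p.2) (Icc 0 D.T ×ˢ univ) := by
  rintro ⟨t, x⟩ ⟨ht, -⟩
  rw [Metric.continuousWithinAt_iff]
  intro ε hε
  obtain ⟨δ, hδ, h⟩ := val_near_symm hD hc (‖x‖ + 1) (half_pos hε)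
  refine ⟨min δ 1, lt_min hδ one_pos, ?_⟩
  rintro ⟨t', x'⟩ ⟨ht', -⟩ hd
  rw [Prod.dist_eq, max_lt_iff] at hd
  have h1 : ‖x' - x‖ < min δ 1 := by simpa [dist_eq_norm] using hd.2
  have h2 : |t' - t| < min δ 1 := by simpa [Real.dist_eq] using hd.1
  rw [Real.dist_eq]
  refine (h t' ht' t ht (h2.le.trans (min_le_left _ _)) x' x ?_ (by linarith)
    (h1.le.trans (min_le_left _ _))).trans_lt (half_lt_self hε)
  have := norm_le_norm_add_norm_sub x x'
  rw [norm_sub_rev] at this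
  linarith [min_le_right δ 1]

/-! ### Dynamic programming inequalities -/

/-- Perform the jump `ξ` at the initial instant, then follow `d`. -/
def ImpulseControl.cons {t : ℝ} (ξ : StateSpace m) (hξ : ξ ≠ 0)
    (d : D.ImpulseControl t) : D.ImpulseControl t where
  time k := Nat.casesOn k t d.time
  impulse k := Nat.casesOn k ξ d.impulse
  le_time k := by
    cases k
    exacts [le_rfl, d.le_time _]
  monotone_time := monotone_nat_of_le_succ fun k => by
    cases k
    exacts [d.le_time 0, d.monotone_time (Nat.le_succ _)]
  impulse_ne_zero k := by
    cases k
    exacts [hξ, d.impulse_ne_zero _]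
  finite_jumps := by
    refine ((d.finite_jumps.image Nat.succ).insert 0).subset fun k hk => ?_
    cases k with
    | zero => exact mem_insert _ _
    | succ k => exact mem_insert_of_mem _ ⟨k, hk, rfl⟩

theorem ImpulseControl.num_cons {t : ℝ} (ξ : StateSpace m) (hξ : ξ ≠ 0) (ht : t ≤ D.T)
    (d : D.ImpulseControl t) : (d.cons ξ hξ).num = d.num + 1 :=
  num_eq _ fun k => by
    cases k with
    | zero => exact ⟨fun _ => ht, fun _ => Nat.succ_pos _⟩
    | succ k => exact Nat.succ_lt_succ_iff.trans d.lt_num_iff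

theorem outcome_cons (hD : D.Standing) (hc : D.Bounds c) {t : ℝ} (ht : t ∈ Icc 0 D.T)
    (x : StateSpace m) (τ : D.Control) (ξ : StateSpace m) (hξ : ξ ≠ 0) (d : D.ImpulseControl t) :
    D.outcome x τ (d.cons ξ hξ) = D.C t x ξ + D.outcome (x + D.g t x ξ) τ d := by
  have h0 : (d.cons ξ hξ).time 0 = t := rfl
  have h1 : (d.cons ξ hξ).impulse 0 = ξ := rfl
  rw [outcome, ImpulseControl.num_cons ξ hξ ht.2, pay, h0, h1, run_self, flow_self hD hc τ ht, zero_add]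
  rfl

theorem val_le_jump [NeZero m] (hD : D.Standing) (hc : D.Bounds c) {t : ℝ} (ht : t ∈ Icc 0 D.T)
    (x : StateSpace m) {ξ : StateSpace m} (hξ : ξ ≠ 0) :
    D.val t x ≤ D.C t x ξ + D.val t (x + D.g t x ξ) := by
  refine le_of_forall_pos_le_add fun ε hε => ?_
  obtain ⟨φ, hφ⟩ := exists_strategy hD hc ht (x + D.g t x ξ) hε
  refine val_le hD hc ht ⟨fun τ => (φ.1 τ).cons ξ hξ, fun τ₁ τ₂ s hs h k hk => ?_⟩
    fun τ => ?_
  · cases k with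
    | zero => exact ⟨rfl, rfl⟩
    | succ k => exact φ.2 τ₁ τ₂ s hs h k hk
  · have := hφ τ
    rw [outcome_cons hD hc ht]
    linarith

theorem val_le_jumps [NeZero m] (hD : D.Standing) (hc : D.Bounds c) {t : ℝ}
    (ht : t ∈ Icc 0 D.T) (l : List (StateSpace m)) : ∀ x : StateSpace m, (∀ ξ ∈ l, ξ ≠ 0) →
      D.val t x ≤ D.val t (D.afterJumps t x l) + D.jumpsCost t x l := by
  induction l with
  | nil => intro x _; simp [afterJumps, jumpsCost]
  | cons ξ l ih =>
    intro x hl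
    have h1 := val_le_jump hD hc ht x (hl ξ List.mem_cons_self)
    have h2 := ih (x + D.g t x ξ) fun ζ hζ => hl ζ (List.mem_cons_of_mem _ hζ)
    rw [afterJumps, jumpsCost]
    linarith

theorem val_le_interv [NeZero m] (hD : D.Standing) (hc : D.Bounds c) {t : ℝ}
    (ht : t ∈ Icc 0 D.T) (κ : ℝ≥0∞) (x : StateSpace m) :
    (D.val t x : EReal) ≤ D.interv κ D.val t x :=
  le_iInf₂ fun l hl => EReal.coe_le_coe_iff.2 (val_le_jumps hD hc ht l x hl.2.1)

/-- Suboptimality of waiting until time `s`. -/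
theorem val_le_of_forall_run [NeZero m] (hD : D.Standing) (hc : D.Bounds c) {t s : ℝ}
    (ht : 0 ≤ t) (hts : t ≤ s) (hs : s ≤ D.T) (x : StateSpace m) {M : ℝ}
    (h : ∀ τ : D.Control, D.run τ t x s + D.val s (D.flow τ t x s) ≤ M) : D.val t x ≤ M := by
  have hs' : s ∈ Icc 0 D.T := ⟨ht.trans hts, hs⟩
  refine le_of_forall_pos_le_add fun ε hε => ?_
  -- Strategies are arbitrary maps, so no measurable selection is needed; non-anticipativity holds
  -- because the state at `s` depends only on the control before `s`.
  choose Φ hΦ using fun p => exists_strategy hD hc hs' p hε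
  refine val_le hD hc ⟨ht, hts.trans hs⟩ (Strategy.delay hts (fun τ => Φ (D.flow τ t x s))
    fun τ₁ τ₂ h => ?_) fun τ => ?_
  · rw [flow_congr hD hc ht hts hs x h s (right_mem_Icc.2 hts)]
  · have h1 := hΦ (D.flow τ t x s) τ
    set d := (Φ (D.flow τ t x s)).1 τ with hd
    change D.pay τ d.num t x d.time d.impulse ≤ _
    rw [pay_eq_run_add hD hc τ x d.impulse ht hts hs d.admissible]
    rw [outcome] at h1
    linarith [h τ]

/-- The impulse control which remains after the first jump. -/
def ImpulseControl.tail {t : ℝ} (d : D.ImpulseControl t) {s : ℝ} (h : d.time 0 = s) :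
    D.ImpulseControl s where
  time k := d.time (k + 1)
  impulse k := d.impulse (k + 1)
  le_time _ := h ▸ d.monotone_time (Nat.zero_le _)
  monotone_time _ _ hjk := d.monotone_time (Nat.succ_le_succ hjk)
  impulse_ne_zero _ := d.impulse_ne_zero _
  finite_jumps := d.finite_jumps.preimage (Nat.succ_injective.injOn)

theorem ImpulseControl.num_tail {t : ℝ} (d : D.ImpulseControl t) {s : ℝ} (h : d.time 0 = s)
    (hs : s ≤ D.T) : d.num = (d.tail h).num + 1 :=
  num_eq _ fun k => by
    cases k with
    | zero => simp [h, hs]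
    | succ k => exact Nat.succ_lt_succ_iff.trans (d.tail h).lt_num_iff

/-- An impulse control on `[t, T]` without jumps before `s`, as an impulse control on `[s, T]`. -/
def ImpulseControl.later {t : ℝ} (d : D.ImpulseControl t) {s : ℝ} (h : s ≤ d.time 0) :
    D.ImpulseControl s :=
  { d with le_time := fun k => h.trans (d.monotone_time (Nat.zero_le k)) }

/-- A strategy either lets the trajectory run until `s`, or jumps for the first time before `s`. In
both cases what remains costs at least the value function in the worst case. -/
theorem first_jump_or_run_le [NeZero m] (hD : D.Standing) (hc : D.Bounds c) {t s : ℝ}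
    (ht : 0 ≤ t) (hts : t ≤ s) (hs : s ≤ D.T) (x : StateSpace m) {M : ℝ} (φ : D.Strategy t)
    (h : ∀ τ, D.outcome x τ (φ.1 τ) ≤ M) (τ₀ : D.Control) :
    (∃ θ ∈ Icc t s, ∃ ξ ≠ 0, D.run τ₀ t x θ + D.C θ (D.flow τ₀ t x θ) ξ +
        D.val θ (D.flow τ₀ t x θ + D.g θ (D.flow τ₀ t x θ) ξ) ≤ M) ∨
      D.run τ₀ t x s + D.val s (D.flow τ₀ t x s) ≤ M := by
  have hsplice : ∀ (τ : D.Control) (r : ℝ), ∀ q ∈ Ico t r, (τ₀.splice r τ).1 q = τ₀.1 q :=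
    fun τ r q hq => Control.splice_of_lt _ _ hq.2
  have hagree : ∀ (r : ℝ), t ≤ r → ∀ τ₁ τ₂ : D.Control, ∀ q ∈ Icc r D.T,
      (∀ p ∈ Ico r q, τ₁.1 p = τ₂.1 p) →
      (φ.1 (τ₀.splice r τ₁)).AgreeUpTo (φ.1 (τ₀.splice r τ₂)) q := fun r hr τ₁ τ₂ q hq hp =>
    φ.2 _ _ q ⟨hr.trans hq.1, hq.2⟩ fun p hp' => by
      rcases lt_or_ge p r with hpr | hpr
      · rw [Control.splice_of_lt _ _ hpr, Control.splice_of_lt _ _ hpr]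
      · rw [Control.splice_of_le _ _ hpr, Control.splice_of_le _ _ hpr]
        exact hp p ⟨hpr, hp'.2⟩
  set θ := (φ.1 τ₀).time 0 with hθ
  have htθ : t ≤ θ := (φ.1 τ₀).le_time 0
  rcases le_or_gt θ s with hθs | hθs
  · left
    set ξ := (φ.1 τ₀).impulse 0 with hξ
    have hθT : θ ≤ D.T := hθs.trans hs
    have hθ' : θ ∈ Icc 0 D.T := ⟨ht.trans htθ, hθT⟩
    refine ⟨θ, ⟨htθ, hθs⟩, ξ, (φ.1 τ₀).impulse_ne_zero 0, ?_⟩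
    -- Controls equal on `[t, θ)` produce the same jumps up to and including `θ`. Hence the first
    -- jump is common to all continuations of `τ₀`, and removing it leaves a strategy on `[θ, T]`.
    have hfirst : ∀ τ, (φ.1 (τ₀.splice θ τ)).time 0 = θ ∧
        (φ.1 (τ₀.splice θ τ)).impulse 0 = ξ := fun τ =>
      φ.2 (τ₀.splice θ τ) τ₀ θ ⟨htθ, hθT⟩ (hsplice τ θ) 0 (Or.inr le_rfl)
    set p := D.flow τ₀ t x θ with hp
    have key := val_le hD hc hθ' (x := p + D.g θ p ξ) (M := M - D.run τ₀ t x θ - D.C θ p ξ)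
      ⟨fun τ => (φ.1 (τ₀.splice θ τ)).tail (hfirst τ).1, fun τ₁ τ₂ q hq hτ k hk =>
        hagree θ htθ τ₁ τ₂ q hq hτ (k + 1) hk⟩ fun τ => by
      set τ₁ := τ₀.splice θ τ with hτ₁
      set d := φ.1 τ₁ with hd
      obtain ⟨e0, e1⟩ : d.time 0 = θ ∧ d.impulse 0 = ξ := hfirst τ
      have hadm : D.Admissible (d.tail e0).num θ (fun k => d.time (k + 1)) :=
        (d.tail e0).admissible
      have hnum := d.num_tail e0 hθT
      change D.pay τ (d.tail e0).num θ _ (fun k => d.time (k + 1))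
        (fun k => d.impulse (k + 1)) ≤ _
      generalize (d.tail e0).num = n at hadm hnum ⊢
      have h1 := h τ₁
      rw [outcome, ← hd, hnum, pay, e0, e1,
        run_congr hD hc ht htθ hθT x (hsplice τ θ),
        flow_congr hD hc ht htθ hθT x (hsplice τ θ) _ (right_mem_Icc.2 htθ), ← hp,
        pay_congr (τ := τ) hD hc _ _ hθ' hadm fun r hr => Control.splice_of_le _ _ hr] at h1
      linarith
    linarith
  · right
    have hs' : s ∈ Icc 0 D.T := ⟨ht.trans hts, hs⟩
    -- A jump before `s` against a spliced control would also occur against `τ₀`, whose first jump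
    -- is later than `s`.
    have hfirst : ∀ τ, s ≤ (φ.1 (τ₀.splice s τ)).time 0 := fun τ => by
      by_contra hlt
      have := (φ.2 (τ₀.splice s τ) τ₀ s ⟨hts, hs⟩ (hsplice τ s) 0 (Or.inl (not_le.1 hlt).le)).1
      exact hlt (this ▸ hθs.le)
    have key := val_le hD hc hs' (x := D.flow τ₀ t x s) (M := M - D.run τ₀ t x s)
      ⟨fun τ => (φ.1 (τ₀.splice s τ)).later (hfirst τ), fun τ₁ τ₂ q hq hτ k hk =>
        hagree s hts τ₁ τ₂ q hq hτ k hk⟩ fun τ => by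
      set τ₁ := τ₀.splice s τ with hτ₁
      set d := φ.1 τ₁ with hd
      have h1 := h τ₁
      have hadm : D.Admissible d.num s d.time := (d.later (hfirst τ)).admissible
      rw [outcome, ← hd, pay_eq_run_add hD hc τ₁ x d.impulse ht hts hs hadm,
        run_congr hD hc ht hts hs x (hsplice τ s),
        flow_congr hD hc ht hts hs x (hsplice τ s) _ (right_mem_Icc.2 hts),
        pay_congr (τ := τ) hD hc _ _ hs' hadm fun r hr => Control.splice_of_le _ _ hr] at h1
      change D.pay τ d.num s _ d.time d.impulse ≤ _
      linarith
    linarith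

/-! ### The terminal condition -/

theorem exists_pay_terminal (hD : D.Standing) (hc : D.Bounds c) (τ : D.Control) {n : ℕ} :
    ∀ (x : StateSpace m) {θ : ℕ → ℝ} {ξ : ℕ → StateSpace m}, D.Admissible n D.T θ →
      (∀ k, ξ k ≠ 0) → ∃ l : List (StateSpace m), l.length = n ∧ (∀ ζ ∈ l, ζ ≠ 0) ∧
        D.pay τ n D.T x θ ξ = D.G (D.afterJumps D.T x l) + D.jumpsCost D.T x l := by
  have hT : D.T ∈ Icc 0 D.T := right_mem_Icc.2 hD.T_pos.le
  induction n with
  | zero =>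
    intro x θ ξ _ _
    exact ⟨[], rfl, by simp, by simp [pay, afterJumps, jumpsCost, flow_self hD hc τ hT]⟩
  | succ n ih =>
    intro x θ ξ hθ hξ
    have h0 : θ 0 = D.T := le_antisymm hθ.head_mem.2 hθ.head_mem.1
    have htail := hθ.tail
    rw [h0] at htail
    obtain ⟨l, hl, hl0, h⟩ := ih (x + D.g D.T x (ξ 0)) htail fun k => hξ (k + 1)
    refine ⟨ξ 0 :: l, by simp [hl], ?_, ?_⟩
    · rintro ζ hζ
      rcases List.mem_cons.1 hζ with rfl | hζ
      exacts [hξ 0, hl0 ζ hζ]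
    · rw [pay, h0, run_self, flow_self hD hc τ hT, h, afterJumps, jumpsCost]
      ring

theorem val_terminal_le [NeZero m] (hD : D.Standing) (hc : D.Bounds c) (x : StateSpace m) :
    D.val D.T x ≤ D.G x := by
  have hT : D.T ∈ Icc 0 D.T := right_mem_Icc.2 hD.T_pos.le
  refine val_le hD hc hT (Strategy.never D le_rfl) fun τ => ?_
  rw [Strategy.never, outcome, ImpulseControl.num_never, pay, run_self, flow_self hD hc τ hT,
    zero_add]

theorem natCast_le_mul_ofReal {κ₀ : ℝ≥0} {κ : ℝ≥0∞} (hκ : (κ₀ : ℝ≥0∞) ≤ κ) {n : ℕ} {a : ℝ}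
    (h : (n : ℝ) ≤ κ₀ * a) : (n : ℝ≥0∞) ≤ κ * ENNReal.ofReal a := by
  refine le_trans ?_ (mul_le_mul_left hκ _)
  rw [← ENNReal.ofReal_natCast, ← ENNReal.ofReal_coe_nnreal, ← ENNReal.ofReal_mul κ₀.coe_nonneg]
  exact ENNReal.ofReal_le_ofReal h

/-- At time `T` only instantaneous jumps remain. Sequences too long for `N` may be discarded,
because their cost already exceeds `G x`. -/
theorem val_terminal [NeZero m] (hD : D.Standing) (hc : D.Bounds c) {α : ℝ} (hα0 : 0 < α)
    (hα : ∀ t ∈ Icc 0 D.T, ∀ x ξ, α ≤ D.C t x ξ) {κ₀ : ℝ≥0} (hκ₀ : 2 * c / α ≤ κ₀) {κ : ℝ≥0∞}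
    (hκ : (κ₀ : ℝ≥0∞) ≤ κ) (x : StateSpace m) : (D.val D.T x : EReal) = D.terminalValue κ x := by
  have hT : D.T ∈ Icc 0 D.T := right_mem_Icc.2 hD.T_pos.le
  refine le_antisymm (le_min (EReal.coe_le_coe_iff.2 (val_terminal_le hD hc x))
    (le_iInf₂ fun l hl => EReal.coe_le_coe_iff.2 ?_)) (not_lt.1 fun hlt => ?_)
  · exact (val_le_jumps hD hc hT l x hl.2.1).trans
      (add_le_add_left (val_terminal_le hD hc _) _)
  · obtain ⟨r, hr1, hr2⟩ := EReal.lt_iff_exists_real_btwn.1 hlt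
    rw [EReal.coe_lt_coe_iff] at hr1
    obtain ⟨φ, hφ⟩ := exists_strategy hD hc hT x (sub_pos.2 hr1)
    obtain ⟨τ⟩ := Control.nonempty hD
    have h1 : D.outcome x τ (φ.1 τ) ≤ r := by linarith [hφ τ]
    obtain ⟨l, hl, hl0, hpay⟩ := exists_pay_terminal hD hc τ x (φ.1 τ).admissible
      (φ.1 τ).impulse_ne_zero
    rw [terminalValue, lt_min_iff, EReal.coe_lt_coe_iff] at hr2
    have hlow := le_pay hD hc τ hα x (φ.1 τ).impulse hT (φ.1 τ).admissible
    rw [outcome] at h1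
    by_cases hn : (((φ.1 τ).num : ℝ)) ≤ κ₀ * (1 + ‖x‖)
    · by_cases hnil : l = []
      · subst hnil
        simp only [afterJumps, jumpsCost, add_zero] at hpay
        linarith [hr2.1]
      · have hmem : l ∈ impulseSeqs κ x := by
          refine ⟨hnil, hl0, ?_⟩
          rw [hl]
          exact natCast_le_mul_ofReal hκ hn
        have h2 : ((r : ℝ) : EReal) < _ := hr2.2.trans_le (iInf₂_le l hmem)
        rw [EReal.coe_lt_coe_iff] at h2
        linarith
    -- With this many jumps the pay-off is at least `2 * c * (1 + ‖x‖) - c`, hence at least `c * (1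
    -- + ‖x‖)`, which bounds `G x`.
    · have h3 : 2 * c * (1 + ‖x‖) ≤ (φ.1 τ).num * α := by
        have : 2 * c / α * (1 + ‖x‖) ≤ κ₀ * (1 + ‖x‖) :=
          mul_le_mul_of_nonneg_right hκ₀ (by positivity)
        have h4 : 2 * c / α * (1 + ‖x‖) ≤ (φ.1 τ).num := this.trans (not_le.1 hn).le
        calc 2 * c * (1 + ‖x‖) = 2 * c / α * (1 + ‖x‖) * α := by field_simp
          _ ≤ _ := mul_le_mul_of_nonneg_right h4 hα0.le
      have h5 := (abs_le.1 (hc.G_growth x)).2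
      have h6 := mul_nonneg hc.nonneg (norm_nonneg x)
      linarith [hr2.1]

/-! ### First order expansion of test functions -/

/-- The increment is split into a move in space at fixed time `t`, handled by differentiability at
`x`, and a move in time at fixed `y`, handled by the mean value inequality and joint continuity of
`φt`. -/
theorem IsC12.expansion {t₀ T : ℝ} {φ φt : ℝ → StateSpace m → ℝ}
    {φx : ℝ → StateSpace m → StateSpace m →L[ℝ] ℝ}
    {φxx : ℝ → StateSpace m → StateSpace m →L[ℝ] StateSpace m →L[ℝ] ℝ}
    (h : IsC12 t₀ T φ φt φx φxx) {t : ℝ} (ht : t ∈ Ico t₀ T) (x : StateSpace m) {ε : ℝ}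
    (hε : 0 < ε) :
    ∃ η > 0, ∀ s ∈ Ico t T, s - t ≤ η → ∀ y, ‖y - x‖ ≤ η →
      |φ s y - φ t x - (φt t x * (s - t) + φx t x (y - x))| ≤ ε * ((s - t) + ‖y - x‖) := by
  have h1 := (hasFDerivAt_iff_isLittleO.1 (h.hasDeriv_x t ht x)).def hε
  obtain ⟨η₁, hη₁, h1⟩ := Metric.eventually_nhds_iff.1 h1
  obtain ⟨η₂, hη₂, h2⟩ := Metric.continuousWithinAt_iff.1 (h.cont_t (t, x) ⟨ht, mem_univ _⟩) ε hε
  refine ⟨min η₁ η₂ / 2, half_pos (lt_min hη₁ hη₂), fun s hs hst y hy => ?_⟩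
  have hm := lt_min hη₁ hη₂
  have hm1 := min_le_left η₁ η₂
  have hm2 := min_le_right η₁ η₂
  have e1 : |φ t y - φ t x - φx t x (y - x)| ≤ ε * ‖y - x‖ := by
    have := h1 (y := y) (by rw [dist_eq_norm]; linarith)
    simpa [Real.norm_eq_abs] using this
  have e2 : |φ s y - φ t y - φt t x * (s - t)| ≤ ε * (s - t) := by
    have hsub : Icc t s ⊆ Ico t₀ T := fun r hr => ⟨ht.1.trans hr.1, hr.2.trans_lt hs.2⟩
    have key := (convex_Icc t s).norm_image_sub_le_of_norm_hasDerivWithin_le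
      (f := fun r => φ r y - φt t x * r) (f' := fun r => φt r y - φt t x * 1) (C := ε)
      (fun r hr => ((h.hasDeriv_t r (hsub hr) y).mono hsub).sub
        ((hasDerivWithinAt_id r _).const_mul _))
      (fun r hr => by
        have hd : dist (r, y) (t, x) < η₂ := by
          rw [Prod.dist_eq, Real.dist_eq, dist_eq_norm, abs_of_nonneg (sub_nonneg.2 hr.1)]
          exact max_lt (by linarith [hr.2]) (by linarith)
        have := (h2 (x := (r, y)) ⟨hsub hr, mem_univ _⟩ hd).le
        rw [Real.dist_eq] at this
        simpa [Real.norm_eq_abs] using this)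
      (left_mem_Icc.2 hs.1) (right_mem_Icc.2 hs.1)
    rw [Real.norm_eq_abs, Real.norm_eq_abs, abs_of_nonneg (sub_nonneg.2 hs.1)] at key
    convert key using 2
    ring
  have : φ s y - φ t x - (φt t x * (s - t) + φx t x (y - x)) =
      (φ s y - φ t y - φt t x * (s - t)) + (φ t y - φ t x - φx t x (y - x)) := by ring
  rw [this]
  refine (abs_add_le _ _).trans ?_
  linarith

/-- First order expansion of a test function along trajectories without jumps, uniform with
respect to the control. -/
theorem IsC12.expansion_flow (hD : D.Standing) (hc : D.Bounds c) {t₀ : ℝ} (ht₀ : 0 ≤ t₀)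
    {φ φt : ℝ → StateSpace m → ℝ} {φx : ℝ → StateSpace m → StateSpace m →L[ℝ] ℝ}
    {φxx : ℝ → StateSpace m → StateSpace m →L[ℝ] StateSpace m →L[ℝ] ℝ}
    (hφ : IsC12 t₀ D.T φ φt φx φxx) {t : ℝ} (ht : t ∈ Ico t₀ D.T) (x : StateSpace m) {ε ρ : ℝ}
    (hε : 0 < ε) (hρ : 0 < ρ) :
    ∃ h > 0, h ≤ ρ ∧ t + h < D.T ∧ ∀ τ : D.Control, ∀ s ∈ Icc t (t + h),
      ‖D.flow τ t x s - x‖ ≤ ρ ∧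
      IntervalIntegrable (fun r => φt t x + φx t x (D.f t x (τ.1 r)) + D.ψ t x (τ.1 r))
        volume t s ∧
      |φ s (D.flow τ t x s) + D.run τ t x s - φ t x -
        ∫ r in t..s, (φt t x + φx t x (D.f t x (τ.1 r)) + D.ψ t x (τ.1 r))| ≤ ε * (s - t) := by
  have htT : t ∈ Icc 0 D.T := ⟨ht₀.trans ht.1, ht.2.le⟩
  have hc0 := hc.nonneg
  set B := c * ((1 + ‖x‖) * Real.exp (c * D.T)) with hB
  have hB0 : 0 ≤ B := by positivity
  set L := ‖φx t x‖ with hL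
  have hL0 : 0 ≤ L := norm_nonneg _
  -- The Taylor remainder contributes `(1 + B) * ε₁` and freezing `f`, `ψ` at `(t, x)` contributes
  -- `(L + 1) * ε₁`, per unit of time.
  set ε₁ := ε / (B + L + 2) with hε₁
  have hε₁0 : 0 < ε₁ := by positivity
  have hεε : ε₁ * (B + L + 2) = ε := by rw [hε₁]; field_simp
  obtain ⟨η, hη, hexp⟩ := hφ.expansion ht x hε₁0
  obtain ⟨δf, hδf, hf⟩ := exists_modulus_of_continuousOn hD.K_compact hD.f_cont (‖x‖ + 1) hε₁0
  obtain ⟨δψ, hδψ, hψ⟩ := exists_modulus_of_continuousOn hD.K_compact hD.ψ_cont (‖x‖ + 1) hε₁0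
  set ρ' := min (min η ρ) (min 1 (min δf δψ)) with hρ'
  have hρ'0 : 0 < ρ' := by positivity
  have r1 : ρ' ≤ η := (min_le_left _ _).trans (min_le_left _ _)
  have r2 : ρ' ≤ ρ := (min_le_left _ _).trans (min_le_right _ _)
  have r3 : ρ' ≤ 1 := (min_le_right _ _).trans (min_le_left _ _)
  have r4 : ρ' ≤ δf := (min_le_right _ _).trans ((min_le_right _ _).trans (min_le_left _ _))
  have r5 : ρ' ≤ δψ := (min_le_right _ _).trans ((min_le_right _ _).trans (min_le_right _ _))
  have hTt : 0 < D.T - t := sub_pos.2 ht.2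
  -- Speed is at most `B`, so up to time `t + h` both the elapsed time and the displacement stay
  -- below `ρ'`.
  set h := min (ρ' / (B + 1)) ((D.T - t) / 2) with hh
  have hh0 : 0 < h := by positivity
  have hhT : h ≤ (D.T - t) / 2 := min_le_right _ _
  have hhB : (B + 1) * h ≤ ρ' := by
    have : h ≤ ρ' / (B + 1) := min_le_left _ _
    rwa [le_div_iff₀ (by positivity), mul_comm] at this
  have hBh : 0 ≤ B * h := by positivity
  have hhρ : h ≤ ρ' := by linarith
  refine ⟨h, hh0, hhρ.trans r2, by linarith, fun τ s hs => ?_⟩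
  have hsT : s ∈ Ico t D.T := ⟨hs.1, by linarith [hs.2]⟩
  have hY : ∀ r ∈ Icc t s, ‖D.flow τ t x r - x‖ ≤ B * (r - t) := fun r hr =>
    norm_flow_sub_le hD hc τ htT x ⟨hr.1, hr.2.trans hsT.2.le⟩
  have hYρ : ∀ r ∈ Icc t s, ‖D.flow τ t x r - x‖ ≤ ρ' := fun r hr => by
    have : B * (r - t) ≤ B * h := mul_le_mul_of_nonneg_left (by linarith [hr.2, hs.2]) hB0
    linarith [hY r hr]
  have hss : s ∈ Icc t s := right_mem_Icc.2 hs.1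
  have hmt : MapsTo (fun p : ℝ × StateSpace m × StateSpace m => (t, x, p.2.2))
      (Icc 0 D.T ×ˢ (univ ×ˢ D.K)) (Icc 0 D.T ×ˢ (univ ×ˢ D.K)) :=
    fun p hp => ⟨htT, mem_univ _, hp.2.2⟩
  have hfi : IntervalIntegrable (fun r => D.f t x (τ.1 r)) volume t s :=
    Control.intervalIntegrable_comp hD.K_compact (hD.f_cont.comp (by fun_prop) hmt) τ htT.1
      hs.1 hsT.2.le (continuousOn_const (c := x))
  have hψi : IntervalIntegrable (fun r => D.ψ t x (τ.1 r)) volume t s :=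
    Control.intervalIntegrable_comp hD.K_compact (hD.ψ_cont.comp (by fun_prop) hmt) τ htT.1
      hs.1 hsT.2.le (continuousOn_const (c := x))
  have hpi : ∀ {u : ℝ → StateSpace m}, IntervalIntegrable u volume t s →
      IntervalIntegrable (fun r => φx t x (u r)) volume t s := fun hu =>
    ⟨(φx t x).integrable_comp hu.1, (φx t x).integrable_comp hu.2⟩
  have hi0 : IntervalIntegrable
      (fun r => φt t x + φx t x (D.f t x (τ.1 r)) + D.ψ t x (τ.1 r)) volume t s :=
    (intervalIntegrable_const.add (hpi hfi)).add hψi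
  have hcY := continuous_flow hD hc τ htT x
  have hfY := hD.intervalIntegrable_f τ htT.1 hs.1 hsT.2.le hcY.continuousOn
  have hψY := hD.intervalIntegrable_ψ τ htT.1 hs.1 hsT.2.le hcY.continuousOn
  refine ⟨(hYρ s hss).trans r2, hi0, ?_⟩
  have e1 := hexp s hsT (by linarith [hs.2]) _ ((hYρ s hss).trans r1)
  have e2 : φx t x (D.flow τ t x s - x) =
      ∫ r in t..s, φx t x (D.f r (D.flow τ t x r) (τ.1 r)) := by
    rw [(φx t x).intervalIntegral_comp_comm hfY, flow_eq hD hc τ htT x ⟨hs.1, hsT.2.le⟩,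
      add_sub_cancel_left]
  have e3 : |∫ r in t..s, ((φt t x + φx t x (D.f r (D.flow τ t x r) (τ.1 r)) +
      D.ψ r (D.flow τ t x r) (τ.1 r)) -
      (φt t x + φx t x (D.f t x (τ.1 r)) + D.ψ t x (τ.1 r)))| ≤ (L + 1) * ε₁ * (s - t) := by
    rw [← Real.norm_eq_abs, ← abs_of_nonneg (sub_nonneg.2 hs.1)]
    refine intervalIntegral.norm_integral_le_of_norm_le_const fun r hr => ?_
    rw [uIoc_of_le hs.1] at hr
    have hr' : r ∈ Icc t s := Ioc_subset_Icc_self hr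
    have hrT : r ∈ Icc 0 D.T := ⟨htT.1.trans hr'.1, hr'.2.trans hsT.2.le⟩
    have hrρ : |r - t| ≤ ρ' := by
      rw [abs_of_nonneg (sub_nonneg.2 hr'.1)]
      linarith [hr'.2, hs.2]
    have hn : ‖D.flow τ t x r‖ ≤ ‖x‖ + 1 := by
      have := norm_le_norm_add_norm_sub' (D.flow τ t x r) x
      linarith [hYρ r hr']
    have f1 := hf r hrT t htT (D.flow τ t x r) x hn (by linarith) (hrρ.trans r4)
      ((hYρ r hr').trans r4) _ (τ.2.2 r)
    have f2 := hψ r hrT t htT (D.flow τ t x r) x hn (by linarith) (hrρ.trans r5)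
      ((hYρ r hr').trans r5) _ (τ.2.2 r)
    dsimp only at f1 f2
    have f3 := ((φx t x).le_opNorm (D.f r (D.flow τ t x r) (τ.1 r) - D.f t x (τ.1 r))).trans
      (mul_le_mul_of_nonneg_left f1 hL0)
    rw [map_sub] at f3
    have : φt t x + φx t x (D.f r (D.flow τ t x r) (τ.1 r)) + D.ψ r (D.flow τ t x r) (τ.1 r) -
        (φt t x + φx t x (D.f t x (τ.1 r)) + D.ψ t x (τ.1 r)) =
        (φx t x (D.f r (D.flow τ t x r) (τ.1 r)) - φx t x (D.f t x (τ.1 r))) +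
        (D.ψ r (D.flow τ t x r) (τ.1 r) - D.ψ t x (τ.1 r)) := by ring
    rw [this]
    refine (norm_add_le _ _).trans ?_
    linarith
  rw [intervalIntegral.integral_sub ((intervalIntegrable_const.add (hpi hfY)).add hψY) hi0,
    intervalIntegral.integral_add (intervalIntegrable_const.add (hpi hfY)) hψY,
    intervalIntegral.integral_add intervalIntegrable_const (hpi hfY),
    intervalIntegral.integral_const, ← e2, smul_eq_mul] at e3
  have e4 := hY s hss
  have e5 : ε₁ * (s - t + ‖D.flow τ t x s - x‖) ≤ ε₁ * ((s - t) + B * (s - t)) :=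
    mul_le_mul_of_nonneg_left (by linarith) hε₁0.le
  have e6 : ε * (s - t) = ε₁ * ((s - t) + B * (s - t)) + (L + 1) * ε₁ * (s - t) := by
    rw [← hεε]
    ring
  rw [abs_le] at e1 e3 ⊢
  rw [e6, run]
  constructor <;> linarith [e1.1, e1.2, e3.1, e3.2]

theorem exists_forall_of_eventually_nhdsWithin {t₀ T t : ℝ} {x : StateSpace m}
    {P : ℝ × StateSpace m → Prop} (h : ∀ᶠ q in 𝓝[Ico t₀ T ×ˢ univ] (t, x), P q) :
    ∃ ρ > 0, ∀ s ∈ Ico t₀ T, |s - t| ≤ ρ → ∀ y, ‖y - x‖ ≤ ρ → P (s, y) := by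
  obtain ⟨ρ, hρ, h⟩ := Metric.eventually_nhds_iff.1 (eventually_nhdsWithin_iff.1 h)
  refine ⟨ρ / 2, half_pos hρ, fun s hs hst y hy => h (y := (s, y)) ?_ ⟨hs, mem_univ _⟩⟩
  rw [Prod.dist_eq, Real.dist_eq, dist_eq_norm]
  exact max_lt (by linarith) (by linarith)

/-! ### The two viscosity inequalities -/

/-- Near the contact point `v ≤ φ`. If the Hamiltonian term exceeded `δ > 0`, waiting for a time `h`
would, against every control, lower `φ` plus running cost by at least `δ / 2 * h`, so the value
would be smaller than itself. -/
theorem isViscositySubsolution_val [NeZero m] (hD : D.Standing) (hc : D.Bounds c) (κ : ℝ≥0∞)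
    {t₀ : ℝ} (ht₀ : 0 ≤ t₀) : D.IsViscositySubsolution κ t₀ D.val := by
  intro t ht x φ φt φx φxx hφ heq hmin
  have htT : t ∈ Icc 0 D.T := ⟨ht₀.trans ht.1, ht.2.le⟩
  refine max_le ?_ (EReal.sub_nonpos.2 (val_le_interv hD hc htT κ x))
  by_contra hpos
  obtain ⟨δ, hδ0, hδ⟩ := EReal.lt_iff_exists_real_btwn.1 (not_le.1 hpos)
  have hδ0' : 0 < δ := by exact_mod_cast hδ0
  have hδ' : ∀ τ ∈ D.K, δ ≤ -φt t x - φx t x (D.f t x τ) - D.ψ t x τ := fun τ hτ =>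
    EReal.coe_le_coe_iff.1 (hδ.le.trans (iInf₂_le τ hτ))
  obtain ⟨ρ, hρ, hloc⟩ := exists_forall_of_eventually_nhdsWithin hmin
  obtain ⟨h, hh, hhρ, hhT, hexp⟩ := hφ.expansion_flow hD hc ht₀ ht x (half_pos hδ0') hρ
  have hs : t + h ∈ Icc t (t + h) := ⟨by linarith, le_rfl⟩
  have hle : D.val t x ≤ D.val t x - δ / 2 * h :=
    val_le_of_forall_run hD hc htT.1 hs.1 hhT.le x fun τ => by
      obtain ⟨h1, h2, h3⟩ := hexp τ _ hs
      have h4 := hloc (t + h) ⟨by linarith [ht.1], hhT⟩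
        (by rw [add_sub_cancel_left, abs_of_pos hh]; exact hhρ) _ h1
      have h5 : ∫ r in t..(t + h), (φt t x + φx t x (D.f t x (τ.1 r)) + D.ψ t x (τ.1 r)) ≤
          ∫ _ in t..(t + h), -δ :=
        intervalIntegral.integral_mono_on hs.1 h2 intervalIntegrable_const fun r _ => by
          linarith [hδ' _ (τ.2.2 r)]
      rw [intervalIntegral.integral_const, smul_eq_mul, add_sub_cancel_left] at h5
      rw [add_sub_cancel_left] at h3
      have h6 := (abs_le.1 h3).2
      dsimp only at h4
      linarith
  have : 0 < δ / 2 * h := by positivity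
  linarith

/-- If both terms were negative, the maximizer could play a constant control `e` for a short time.
Letting the trajectory run then costs the minimizer about `a` per unit of time, and jumping costs a
fixed gap `δ`, up to small errors; a near-optimal strategy must do one or the other. -/
theorem isViscositySupersolution_val [NeZero m] (hD : D.Standing) (hc : D.Bounds c) {κ : ℝ≥0∞}
    (hκ : 1 ≤ κ) {t₀ : ℝ} (ht₀ : 0 ≤ t₀) : D.IsViscositySupersolution κ t₀ D.val := by
  intro t ht x φ φt φx φxx hφ heq hmax
  have htT : t ∈ Icc 0 D.T := ⟨ht₀.trans ht.1, ht.2.le⟩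
  have hc0 := hc.nonneg
  by_contra hneg
  obtain ⟨hneg1, hneg2⟩ := max_lt_iff.1 (not_le.1 hneg)
  obtain ⟨e, he⟩ := iInf_lt_iff.1 hneg1
  obtain ⟨heK, he⟩ := iInf_lt_iff.1 he
  set a := φt t x + φx t x (D.f t x e) + D.ψ t x e with ha
  have ha0 : 0 < a := by
    have : -φt t x - φx t x (D.f t x e) - D.ψ t x e < 0 := by exact_mod_cast he
    linarith
  obtain ⟨r, hr1, hr2⟩ := EReal.lt_iff_exists_real_btwn.1 ((EReal.sub_neg
    (Or.inl (EReal.coe_ne_top _)) (Or.inl (EReal.coe_ne_bot _))).1 hneg2)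
  rw [EReal.coe_lt_coe_iff] at hr1
  set δ := r - D.val t x with hδ
  have hδ0 : 0 < δ := sub_pos.2 hr1
  -- Single jumps suffice, since the value after the first jump already accounts for any further
  -- ones; only `1 ≤ κ` is needed for them to be allowed.
  have hgap : ∀ ξ : StateSpace m, ξ ≠ 0 →
      D.val t x + δ ≤ D.val t (x + D.g t x ξ) + D.C t x ξ := fun ξ hξ => by
    have hmem : [ξ] ∈ impulseSeqs κ x := by
      refine ⟨by simp, by simpa using hξ, ?_⟩
      rw [List.length_singleton]
      refine natCast_le_mul_ofReal (κ₀ := 1) (by simpa using hκ) ?_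
      simp
    have := hr2.le.trans (iInf₂_le [ξ] hmem)
    rw [EReal.coe_le_coe_iff] at this
    simp only [afterJumps, jumpsCost, add_zero] at this
    linarith
  set R := ‖x‖ + 1 with hR
  have hR0 : 0 ≤ R := by positivity
  have hδ4 : 0 < δ / 4 := by positivity
  obtain ⟨δ₁, hδ₁, h₁⟩ := val_near_symm hD hc (R + c * (1 + R)) hδ4
  obtain ⟨δ₂, hδ₂, h₂⟩ := exists_modulus_of_equicontinuousOn (equicontinuousOn_jump hD hc) R
    (half_pos hδ₁)
  obtain ⟨δ₃, hδ₃, h₃⟩ := exists_modulus_of_equicontinuousOn hD.C_equicont R hδ4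
  obtain ⟨ρ₀, hρ₀, hloc⟩ := exists_forall_of_eventually_nhdsWithin hmax
  set ρ := min (min ρ₀ 1) (min (δ₁ / 2) (min δ₂ δ₃)) with hρ
  have hρ0 : 0 < ρ := by positivity
  have r1 : ρ ≤ ρ₀ := (min_le_left _ _).trans (min_le_left _ _)
  have r2 : ρ ≤ 1 := (min_le_left _ _).trans (min_le_right _ _)
  have r3 : ρ ≤ δ₁ / 2 := (min_le_right _ _).trans (min_le_left _ _)
  have r4 : ρ ≤ δ₂ := (min_le_right _ _).trans ((min_le_right _ _).trans (min_le_left _ _))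
  have r5 : ρ ≤ δ₃ := (min_le_right _ _).trans ((min_le_right _ _).trans (min_le_right _ _))
  obtain ⟨h, hh, hhρ, hhT, hexp⟩ := hφ.expansion_flow hD hc ht₀ ht x (half_pos ha0) hρ0
  let τ₀ : D.Control := ⟨fun _ => e, measurable_const, fun _ => heK⟩
  -- Moving from `(s, p)` back to `(t, x)` loses at most `δ / 4` three times, so a jump still costs
  -- an excess `δ / 4 > δ / 8`; running until `t + h` costs an excess `a / 2 * h > a / 4 * h`.
  have hε : 0 < min (δ / 8) (a / 4 * h) := by positivity
  have hε1 := min_le_left (δ / 8) (a / 4 * h)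
  have hε2 := min_le_right (δ / 8) (a / 4 * h)
  have hlow : ∀ s ∈ Icc t (t + h),
      D.val t x + a / 2 * (s - t) ≤ D.run τ₀ t x s + D.val s (D.flow τ₀ t x s) := fun s hs => by
    obtain ⟨h1, h2, h3⟩ := hexp τ₀ s hs
    have h4 := hloc s ⟨ht.1.trans hs.1, hs.2.trans_lt hhT⟩
      (by rw [abs_of_nonneg (sub_nonneg.2 hs.1)]; linarith [hs.2]) _ (h1.trans r1)
    have h5 : ∫ r in t..s, (φt t x + φx t x (D.f t x (τ₀.1 r)) + D.ψ t x (τ₀.1 r)) =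
        (s - t) * a := intervalIntegral.integral_const a
    rw [h5] at h3
    have h6 := (abs_le.1 h3).1
    dsimp only at h4
    linarith
  obtain ⟨Φ, hΦ⟩ := exists_strategy hD hc htT x hε
  rcases first_jump_or_run_le hD hc htT.1 (by linarith) hhT.le x Φ hΦ τ₀ with
    ⟨s, hs, ξ, hξ, hle⟩ | hle
  · set p := D.flow τ₀ t x s with hp
    have hsT : s ∈ Icc 0 D.T := ⟨htT.1.trans hs.1, (hs.2.trans_lt hhT).le⟩
    have hpx : ‖p - x‖ ≤ ρ := (hexp τ₀ s hs).1
    have hst : |s - t| ≤ ρ := by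
      rw [abs_of_nonneg (sub_nonneg.2 hs.1)]
      linarith [hs.2]
    have hpR : ‖p‖ ≤ R := by
      have := norm_le_norm_add_norm_sub' p x
      linarith
    have hxR : ‖x‖ ≤ R := by linarith
    have hcR : 0 ≤ c * (1 + R) := by positivity
    have hnorm : ∀ {s : ℝ}, s ∈ Icc 0 D.T → ∀ {q : StateSpace m}, ‖q‖ ≤ R →
        ‖q + D.g s q ξ‖ ≤ R + c * (1 + R) := fun {s} hs {q} hq =>
      (norm_add_le _ _).trans (add_le_add hq ((hc.g_growth s hs q ξ).trans (by gcongr)))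
    have f1 := h₁ s hsT t htT (by linarith) p x (by linarith) (by linarith) (by linarith)
    have f2 := h₂ s hsT t htT p x hpR hxR (hst.trans r4) (hpx.trans r4) ξ
    have f3 := h₃ s hsT t htT p x hpR hxR (hst.trans r5) (hpx.trans r5) ξ
    have f4 := h₁ s hsT t htT (by linarith) (p + D.g s p ξ) (x + D.g t x ξ) (hnorm hsT hpR)
      (hnorm htT hxR) (by
        rw [add_sub_add_comm]
        refine (norm_add_le _ _).trans ?_
        linarith)
    rw [Real.norm_eq_abs] at f3
    have f5 := hgap ξ hξ
    have f6 := hlow s hs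
    have f7 : 0 ≤ a / 2 * (s - t) := mul_nonneg (by positivity) (sub_nonneg.2 hs.1)
    rw [abs_le] at f1 f3 f4
    dsimp only at f3
    linarith [f1.2, f3.1, f4.1]
  · have f6 := hlow (t + h) ⟨by linarith, le_rfl⟩
    rw [add_sub_cancel_left] at f6
    have : 0 < a * h := by positivity
    linarith

end ImpulseGame

end

theorem theorem4 {m : ℕ} (hm : 0 < m) (D : ImpulseGame m) (hD : D.Standing) :
    ∃ v : ℝ → StateSpace m → ℝ,
      (∀ t ∈ Set.Icc 0 D.T, ∀ x, D.value t x = (v t x : EReal)) ∧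
      ∃ κ₀ : NNReal, ∀ κ : ENNReal, (κ₀ : ENNReal) ≤ κ → ∀ t₀ ∈ Set.Ico 0 D.T,
        D.IsViscositySolution κ t₀ v := by
  have : NeZero m := ⟨hm.ne'⟩
  obtain ⟨c, hc⟩ := hD.exists_bounds
  obtain ⟨α, hα0, hα⟩ := hD.C_lower
  refine ⟨D.val, fun t ht x => ImpulseGame.value_eq_val hD hc ht x,
    -- The 1 is for the supersolution property, the quotient for the terminal condition; the
    -- subsolution property holds for every `κ`.
    max 1 (2 * c / α).toNNReal, fun κ hκ t₀ ht₀ => ?_⟩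
  have hκ1 : (1 : ENNReal) ≤ κ := le_trans (by exact_mod_cast le_max_left _ _) hκ
  refine ⟨ImpulseGame.continuousOn_val hD hc, fun x =>
    ImpulseGame.val_terminal hD hc hα0 hα ?_ hκ x,
    ImpulseGame.isViscositySupersolution_val hD hc hκ1 ht₀.1,
    ImpulseGame.isViscositySubsolution_val hD hc κ ht₀.1⟩
  exact (Real.le_coe_toNNReal _).trans (by exact_mod_cast le_max_right _ _)
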